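/- Let $d,T,\beta,\gamma,\eta,r>0$, $\sigma\in\mathbb{R}$, and let $b\in L^2([-d,0];\mathbb{R}_+)$. Consider the mean field game in which the representative firm, with production level $$dk(t)=\Big[\alpha(t)+\int_{-d}^0 b(\xi)\alpha(t+\xi)\,d\xi\Big]dt+\sigma\,dW(t),\qquad 0\le t\le T,$$ minimizes, given the population distribution $\nu$ of production levels, with $\bar\nu(t):=\int_{\mathbb{R}}\xi\,\nu(t,d\xi)$, $$\frac12\,\mathbb{E}\Big[\int_0^T\big[(k(t)-\beta\eta+\beta\gamma\bar\nu(t))^2+r\alpha(t)^2\big]dt+(k(T)-\beta\eta+\beta\gamma\bar\nu(T))^2\Big].$$ Reformulate it in the Hilbert space $H=\mathbb{R}\times L^2(-d,0)$, with $\langle x,y\rangle=x_0y_0+\int_{-d}^0x_1y_1\,d\xi$, as follows. Let $A(x_0,x_1)=(x_1(0),-x_1')$ with domain $D(A)=\{(x_0,x_1)\in H: x_1\in W^{1,2}(-d,0),\ x_1(-d)=0\}$. Put $B:\mathbb{R}\to H$, $B\alpha=(1,b)\alpha$; $G:\mathbb{R}\to H$, $Gw=(\sigma w,0)$; $R=r$;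 $\overline Qx=(x_0,0)$; $S=-\beta\gamma I$; $n=(\beta\eta,0)\in H$. Let $m_0$ be a Borel probability measure on $H$ with $\int_H|x|\,m_0(dx)<\infty$, and let $z_0=\int_H x\,m_0(dx)$ be its mean. Then $A$ generates a $C_0$-semigroup $(e^{tA})_{t\ge0}$ on $H$, and, with $e^{tA^*}=(e^{tA})^*$, there is exactly one LQM (linear-quadratic-mean) mild solution of the game. That is, there is exactly one quadruple $(P,\mathbf r,z,s)$ of functions on $[0,T]$ such that $P$ takes values in the nonnegative self-adjoint bounded operators on $H$ and is strongly continuous, $\mathbf r,z\in C([0,T];H)$, $s\in C([0,T];\mathbb{R})$, and for all $t\in[0,T]$ and $x\in H$: $$P(t)x=e^{(T-t)A^*}\overline Qe^{(T-t)A}x+\int_t^Te^{(\tau-t)A^*}\overline Qe^{(\tau-t)A}x\,d\tau-\int_t^Te^{(\tau-t)A^*}P(\tau)BR^{-1}B^*P(\tau)e^{(\tau-t)A}x\,d\tau,$$ $$z(t)=e^{tA}z_0-\int_0^te^{(t-\tau)A}BR^{-1}B^*P(\tau)z(\tau)\,d\tau-\int_0^te^{(t-\tau)A}BR^{-1}B^*\mathbf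 r(\tau)\,d\tau,$$ $$\mathbf r(t)=e^{(T-t)A^*}\big(-\overline QSz(T)-n\big)-\int_t^Te^{(\tau-t)A^*}P(\tau)BR^{-1}B^*\mathbf r(\tau)\,d\tau-\int_t^Te^{(\tau-t)A^*}\big(\overline QSz(\tau)+n\big)\,d\tau,$$ $$s(t)=\tfrac12\big(\beta\eta-\beta\gamma z(T)_0\big)^2+\int_t^T\Big[\tfrac12\mathrm{Tr}[GG^*P(\tau)]-\tfrac12\langle BR^{-1}B^*\mathbf r(\tau),\mathbf r(\tau)\rangle+\tfrac12\big(\beta\eta-\beta\gamma z(\tau)_0\big)^2\Big]d\tau,$$ where $y_0$ denotes the $\mathbb{R}$-component of $y\in H$. -/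

import Mathlib

open MeasureTheory Filter Topology Set
open scoped ContDiff InnerProductSpace

noncomputable section

/-! ### Strongly continuous semigroups -/

/-- `E` restricted to `[0,∞)` is a `C₀`-semigroup of bounded operators on `H`
(the values `E t` for `t < 0` play no role). -/
structure IsC0Semigroup {H : Type*} [NormedAddCommGroup H] [NormedSpace ℝ H]
    (E : ℝ → H →L[ℝ] H) : Prop where
  map_zero : E 0 = ContinuousLinearMap.id ℝ H
  map_add : ∀ s t : ℝ, 0 ≤ s → 0 ≤ t → E (s + t) = (E s).comp (E t)
  continuousOn : ∀ x : H, ContinuousOn (fun t => E t x) (Ici 0)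

/-- The unbounded operator whose graph is `Γ` (`Γ x y` means `x ∈ D(A)` and `A x = y`) is the
infinitesimal generator of `E`: `x ∈ D(A)` and `A x = y` if and only if `(E h x - x) / h → y`
as `h ↓ 0`. -/
def IsGeneratorGraph {H : Type*} [NormedAddCommGroup H] [NormedSpace ℝ H]
    (E : ℝ → H →L[ℝ] H) (Γ : H → H → Prop) : Prop :=
  ∀ x y : H, Γ x y ↔ Tendsto (fun h : ℝ => h⁻¹ • (E h x - x)) (𝓝[>] 0) (𝓝 y)

/-! ### Linear-quadratic-mean (LQM) mild solutions -/

/-- The trace `∑ᵢ ⟨eᵢ, L eᵢ⟩` of an operator, computed in a Hilbert basis of `H`. -/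
def opTrace {H : Type*} [NormedAddCommGroup H] [InnerProductSpace ℝ H] [CompleteSpace H]
    (L : H →L[ℝ] H) : ℝ :=
  ∑' e : ↥(exists_hilbertBasis ℝ H).choose, ⟪(e : H), L (e : H)⟫_ℝ

/-- Coefficients, apart from the operator `A`, of a linear-quadratic mean field game with state
equation `dX = (A X + B α) ds + σ dW`, running cost
`½ (⟨R α, α⟩ + ⟨Q x, x⟩ + ⟨Qbar (x - S z), x - S z⟩) + ⟨ℓ, x⟩ + c z` and terminal cost
`½ (⟨QT x, x⟩ + ⟨QbarT (x - ST z), x - ST z⟩) + ⟨ℓT, x⟩ + cT z`,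
where `z` is the mean of the population. -/
structure LQMData (H U K : Type*) [NormedAddCommGroup H] [InnerProductSpace ℝ H]
    [NormedAddCommGroup U] [InnerProductSpace ℝ U]
    [NormedAddCommGroup K] [InnerProductSpace ℝ K] where
  B : U →L[ℝ] H
  R : U →L[ℝ] U
  Q : H →L[ℝ] H
  QT : H →L[ℝ] H
  Qbar : H →L[ℝ] H
  QbarT : H →L[ℝ] H
  S : H →L[ℝ] H
  ST : H →L[ℝ] H
  σ : K →L[ℝ] H
  ℓ : H
  ℓT : H
  c : H → ℝ
  cT : H → ℝ

namespace LQMData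

variable {H U K : Type*} [NormedAddCommGroup H] [InnerProductSpace ℝ H] [CompleteSpace H]
  [NormedAddCommGroup U] [InnerProductSpace ℝ U] [CompleteSpace U]
  [NormedAddCommGroup K] [InnerProductSpace ℝ K] [CompleteSpace K]

/-- The operator `B R⁻¹ B*`. -/
def BRB (D : LQMData H U K) : H →L[ℝ] H :=
  D.B ∘L D.R.inverse ∘L ContinuousLinearMap.adjoint D.B

/-- `P ∈ C_s([0,T]; Σ⁺(H))` is a mild solution of the backward Riccati equation
`P' + P A + A* P - P B R⁻¹ B* P + Q + Qbar = 0`, `P(T) = QT + QbarT`; `E t` stands for `e^{tA}`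
and its adjoint for `e^{tA*}`. -/
structure IsMildRiccati (D : LQMData H U K) (E : ℝ → H →L[ℝ] H) (T : ℝ)
    (P : ℝ → H →L[ℝ] H) : Prop where
  isPositive : ∀ t ∈ Icc 0 T, (P t).IsPositive
  continuousOn : ∀ x : H, ContinuousOn (fun t => P t x) (Icc 0 T)
  eq : ∀ x : H, ∀ t ∈ Icc 0 T,
    P t x = ContinuousLinearMap.adjoint (E (T - t)) ((D.QT + D.QbarT) (E (T - t) x))
      + (∫ τ in t..T, ContinuousLinearMap.adjoint (E (τ - t)) ((D.Q + D.Qbar) (E (τ - t) x)))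
      - ∫ τ in t..T,
          ContinuousLinearMap.adjoint (E (τ - t)) (P τ (D.BRB (P τ (E (τ - t) x))))

/-- `(z, r) ∈ C([0,T]; H²)` is a mild solution of the forward-backward system
`z' = (A - B R⁻¹ B* P) z - B R⁻¹ B* r`, `z(0) = z₀`,
`r' + (A* - P B R⁻¹ B*) r - Qbar S z + ℓ = 0`, `r(T) = - QbarT ST z(T) + ℓT`. -/
structure IsMildForwardBackward (D : LQMData H U K) (E : ℝ → H →L[ℝ] H) (T : ℝ) (z₀ : H)
    (P : ℝ → H →L[ℝ] H) (z r : ℝ → H) : Prop where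
  continuousOn_z : ContinuousOn z (Icc 0 T)
  continuousOn_r : ContinuousOn r (Icc 0 T)
  eq_z : ∀ t ∈ Icc 0 T,
    z t = E t z₀ - (∫ τ in (0 : ℝ)..t, E (t - τ) (D.BRB (P τ (z τ))))
      - ∫ τ in (0 : ℝ)..t, E (t - τ) (D.BRB (r τ))
  eq_r : ∀ t ∈ Icc 0 T,
    r t = ContinuousLinearMap.adjoint (E (T - t)) (-D.QbarT (D.ST (z T)) + D.ℓT)
      - (∫ τ in t..T, ContinuousLinearMap.adjoint (E (τ - t)) (P τ (D.BRB (r τ))))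
      - ∫ τ in t..T, ContinuousLinearMap.adjoint (E (τ - t)) (D.Qbar (D.S (z τ)) - D.ℓ)

/-- `(P, r, z, s)` is an LQM mild solution of the mean field game: the value function is
`v(t,x) = ½ ⟨P(t) x, x⟩ + ⟨r(t), x⟩ + s(t)` and the mean of the population is `z(t)`. -/
structure IsLQMMildSolution (D : LQMData H U K) (E : ℝ → H →L[ℝ] H) (T : ℝ) (z₀ : H)
    (P : ℝ → H →L[ℝ] H) (r z : ℝ → H) (s : ℝ → ℝ) : Prop where
  riccati : D.IsMildRiccati E T P
  forwardBackward : D.IsMildForwardBackward E T z₀ P z r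
  continuousOn_s : ContinuousOn s (Icc 0 T)
  eq_s : ∀ t ∈ Icc 0 T,
    s t = 1 / 2 * ⟪D.QbarT (D.ST (z T)), D.ST (z T)⟫_ℝ + D.cT (z T)
      + ∫ τ in t..T,
          (1 / 2 * opTrace (D.σ ∘L ContinuousLinearMap.adjoint D.σ ∘L P τ)
            - 1 / 2 * ⟪D.BRB (r τ), r τ⟫_ℝ
            + 1 / 2 * ⟪D.Qbar (D.S (z τ)), D.S (z τ)⟫_ℝ + D.c (z τ))

end LQMData

/-! ### Production output planning with time-to-build delay -/

/-- `L²(-d,0)`. -/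
abbrev DelayL2 (d : ℝ) : Type := Lp ℝ 2 (volume.restrict (Icc (-d) 0))

/-- `H = ℝ × L²(-d,0)` with inner product `⟨x, y⟩ = x₀ y₀ + ∫ x₁ y₁`. -/
abbrev DelaySpace (d : ℝ) : Type := WithLp 2 (ℝ × DelayL2 d)

/-- `g` is the weak derivative of `f` on `(-d,0)`. -/
def IsWeakDeriv {d : ℝ} (f g : DelayL2 d) : Prop :=
  ∀ φ : ℝ → ℝ, ContDiff ℝ ∞ φ → tsupport φ ⊆ Ioo (-d) 0 →
    ∫ ξ in Icc (-d) 0, f ξ * deriv φ ξ = -∫ ξ in Icc (-d) 0, g ξ * φ ξ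

/-- The graph of the operator `A (x₀, x₁) = (x₁(0), -x₁')` with domain
`D(A) = {(x₀, x₁) : x₁ ∈ W^{1,2}(-d,0), x₁(-d) = 0}`; the boundary values are those of the
continuous representative `u` of `x₁`. -/
def delayOperatorGraph (d : ℝ) (x y : DelaySpace d) : Prop :=
  IsWeakDeriv x.snd (-y.snd) ∧
    ∃ u : ℝ → ℝ, ContinuousOn u (Icc (-d) 0) ∧
      (∀ᵐ ξ ∂(volume.restrict (Icc (-d) 0)), x.snd ξ = u ξ) ∧ u (-d) = 0 ∧ y.fst = u 0

/-- The operator `x ↦ (x₀, 0)` on `H`. -/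
def delayProj (d : ℝ) : DelaySpace d →L[ℝ] DelaySpace d :=
  (WithLp.prodContinuousLinearEquiv 2 ℝ ℝ (DelayL2 d)).symm.toContinuousLinearMap ∘L
    ContinuousLinearMap.inl ℝ ℝ (DelayL2 d) ∘L ContinuousLinearMap.fst ℝ ℝ (DelayL2 d) ∘L
      (WithLp.prodContinuousLinearEquiv 2 ℝ ℝ (DelayL2 d)).toContinuousLinearMap

/-- Coefficients of the production planning game: `B α = α (1, b)`, `G w = (σ w, 0)`, running cost
`½ ((x₀ - β η + β γ z₀)² + r α²)` and terminal cost `½ (x₀ - β η + β γ z₀)²`, where `z₀` is the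
mean of the `ℝ`-component. Expanding the square gives `Q = 0`, `Qbar x = (x₀, 0)`, `S = -β γ I`,
the linear term `-β η x₀` and the state-independent term `½ ((β η)² - 2 η β² γ z₀)`. -/
def productionData (d β γ η r σ : ℝ) (b : DelayL2 d) : LQMData (DelaySpace d) ℝ ℝ where
  B := ContinuousLinearMap.toSpanSingleton ℝ (WithLp.toLp 2 ((1 : ℝ), b))
  R := r • ContinuousLinearMap.id ℝ ℝ
  Q := 0
  QT := 0
  Qbar := delayProj d
  QbarT := delayProj d
  S := (-(β * γ)) • ContinuousLinearMap.id ℝ (DelaySpace d)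
  ST := (-(β * γ)) • ContinuousLinearMap.id ℝ (DelaySpace d)
  σ := ContinuousLinearMap.toSpanSingleton ℝ (WithLp.toLp 2 (σ, (0 : DelayL2 d)))
  ℓ := -WithLp.toLp 2 (β * η, (0 : DelayL2 d))
  ℓT := -WithLp.toLp 2 (β * η, (0 : DelayL2 d))
  c := fun z => 1 / 2 * ((β * η) ^ 2 - 2 * η * β ^ 2 * γ * z.fst)
  cT := fun z => 1 / 2 * ((β * η) ^ 2 - 2 * η * β ^ 2 * γ * z.fst)

end

/-!
A mild solution of the game amounts to the Riccati equation for `P`, a forward-backward system for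
`(z, r)`, and a quadrature for `s`. The control is scalar, so `B R⁻¹ B* = ⟪v, ·⟫ v`, and the
quadratic term of the Riccati equation only involves the gain `P v`, which itself solves a Volterra
equation with locally Lipschitz kernel. That equation is solved globally after truncating its
nonlinearity; completing the square bounds `P` a priori, so that the truncation is inactive.

In terms of the costate `p = P z + r`, the forward-backward system is a Hamiltonian system in which
`P` no longer appears. When the cost operators of this system, here `(1 + β γ)` times the projection
onto the first component, are nonnegative, the solution of a second Riccati equation decouples the
system, whence existence; duality between the difference of two states and the difference of their
costates gives uniqueness. Passing to mild equations with `e^{tA*}` requires the adjoint semigroup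
to be strongly continuous, which holds on a Hilbert space: the vectors with a continuous adjoint
orbit form a closed subspace that is orthogonal to no nonzero vector.

The semigroup generated by `A` translates `x₁` to the right, fills in zeros, and adds the mass
pushed beyond `0` to `x₀`.
-/

section Volterra

variable {X : Type*} [NormedAddCommGroup X]

theorem continuous_intervalIntegral_left [NormedSpace ℝ X] {f : ℝ → ℝ → X}
    (hf : Continuous (Function.uncurry f)) (b : ℝ) : Continuous fun t => ∫ τ in t..b, f t τ := by
  simp_rw [intervalIntegral.integral_symm b]
  exact (intervalIntegral.continuous_parametric_intervalIntegral_of_continuous hf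
    continuous_id).neg

theorem intervalIntegral_triangle_swap [NormedSpace ℝ X] {a b : ℝ} (hab : a ≤ b) {f : ℝ → ℝ → X}
    (hf : Integrable (Function.uncurry f)
      ((volume.restrict (Ioc a b)).prod (volume.restrict (Ioc a b)))) :
    ∫ τ in a..b, ∫ σ in a..τ, f τ σ = ∫ σ in a..b, ∫ τ in σ..b, f τ σ := by
  have hΔ : MeasurableSet {p : ℝ × ℝ | p.2 ≤ p.1} :=
    measurableSet_le measurable_snd measurable_fst
  have inner_right : ∀ τ ∈ Ioc a b,
      ∫ σ in a..τ, f τ σ = ∫ σ in Ioc a b, (Iic τ).indicator (f τ) σ := fun τ hτ => by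
    rw [setIntegral_indicator measurableSet_Iic, Ioc_inter_Iic, min_eq_right hτ.2,
      intervalIntegral.integral_of_le hτ.1.le]
  have inner_left : ∀ σ ∈ Ioc a b,
      ∫ τ in σ..b, f τ σ = ∫ τ in Ioc a b, (Ici σ).indicator (f · σ) τ := fun σ hσ => by
    have hinter : Ioc a b ∩ Ici σ = Icc σ b :=
      Set.ext fun τ => ⟨fun h => ⟨h.2, h.1.2⟩, fun h => ⟨⟨hσ.1.trans_le h.1, h.2⟩, h.1⟩⟩
    rw [setIntegral_indicator measurableSet_Ici, hinter, integral_Icc_eq_integral_Ioc,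
      intervalIntegral.integral_of_le hσ.2]
  rw [intervalIntegral.integral_of_le hab, intervalIntegral.integral_of_le hab,
    setIntegral_congr_fun measurableSet_Ioc inner_right,
    setIntegral_congr_fun measurableSet_Ioc inner_left]
  exact integral_integral_swap (hf.indicator hΔ)

theorem intervalIntegral_triangle_swap_of_continuous [NormedSpace ℝ X] {a b : ℝ} (hab : a ≤ b)
    {f : ℝ → ℝ → X} (hf : Continuous (Function.uncurry f)) :
    ∫ τ in a..b, ∫ σ in a..τ, f τ σ = ∫ σ in a..b, ∫ τ in σ..b, f τ σ := by
  refine intervalIntegral_triangle_swap hab ?_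
  rw [Measure.prod_restrict]
  exact (hf.continuousOn.integrableOn_compact (isCompact_Icc.prod isCompact_Icc)).mono_set
    (prod_mono Ioc_subset_Icc_self Ioc_subset_Icc_self)

theorem eqOn_zero_of_norm_le_mul_integral_norm {a b L : ℝ} {w : ℝ → X} (hw : Continuous w)
    (h : ∀ t ∈ Icc a b, ‖w t‖ ≤ L * ∫ τ in a..t, ‖w τ‖) : EqOn w 0 (Icc a b) := by
  have hderiv : ∀ t, HasDerivAt (fun t => ∫ τ in a..t, ‖w τ‖) ‖w t‖ t := fun t =>
    (hw.norm.integral_hasStrictDerivAt a t).hasDerivAt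
  have hprim : ∀ t ∈ Icc a b, ∫ τ in a..t, ‖w τ‖ = 0 := by
    refine eq_zero_of_abs_deriv_le_mul_abs_self_of_eq_zero_right (K := L)
      (f' := fun t => ‖w t‖) (fun t _ => (hderiv t).continuousAt.continuousWithinAt)
      (fun t _ => (hderiv t).hasDerivWithinAt) intervalIntegral.integral_same fun t ht => ?_
    have hnonneg : 0 ≤ ∫ τ in a..t, ‖w τ‖ :=
      intervalIntegral.integral_nonneg ht.1 fun _ _ => norm_nonneg _
    simpa only [norm_norm, Real.norm_eq_abs, abs_norm, abs_of_nonneg hnonneg]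
      using h t ⟨ht.1, ht.2.le⟩
  intro t ht
  have ht' := h t ht
  rw [hprim t ht, mul_zero] at ht'
  exact norm_le_zero_iff.1 ht'

theorem eqOn_zero_of_norm_le_mul_integral_norm_backward {a b L : ℝ} {w : ℝ → X}
    (hw : Continuous w) (h : ∀ t ∈ Icc a b, ‖w t‖ ≤ L * ∫ τ in t..b, ‖w τ‖) :
    EqOn w 0 (Icc a b) := by
  have hrefl : EqOn (fun s => w (-s)) 0 (Icc (-b) (-a)) := by
    refine eqOn_zero_of_norm_le_mul_integral_norm (L := L) (by fun_prop) fun s hs => ?_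
    rw [intervalIntegral.integral_comp_neg (fun τ => ‖w τ‖), neg_neg]
    exact h (-s) ⟨le_neg.2 hs.2, neg_le.2 hs.1⟩
  exact fun t ht => by simpa using hrefl ⟨neg_le_neg ht.2, neg_le_neg ht.1⟩

variable [NormedSpace ℝ X] [CompleteSpace X]

theorem exists_volterra_solution_of_integral_le_half {a b : ℝ} (hab : a ≤ b) {g : ℝ → X}
    (hg : Continuous g) {k : ℝ → ℝ → X → X}
    (hk : Continuous fun p : ℝ × ℝ × X => k p.1 p.2.1 p.2.2) {κ : ℝ → ℝ → ℝ}
    (hκ : ∀ t, Continuous (κ t)) (hκ_nonneg : ∀ t τ, 0 ≤ κ t τ)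
    (hκ_int : ∀ t ∈ Icc a b, ∫ τ in a..t, κ t τ ≤ 1 / 2)
    (hLip : ∀ t ∈ Icc a b, ∀ τ ∈ Icc a t, ∀ x y, ‖k t τ x - k t τ y‖ ≤ κ t τ * ‖x - y‖) :
    ∃ f : ℝ → X, Continuous f ∧ ∀ t ∈ Icc a b, f t = g t + ∫ τ in a..t, k t τ (f τ) := by
  have hkφ : ∀ φ : C(Icc a b, X),
      Continuous fun p : ℝ × ℝ => k p.1 p.2 (φ (projIcc a b hab p.2)) := fun φ =>
    hk.comp (continuous_fst.prodMk (continuous_snd.prodMk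
      (φ.continuous.comp (continuous_projIcc.comp continuous_snd))))
  have hcont : ∀ φ : C(Icc a b, X),
      Continuous fun t => g t + ∫ τ in a..t, k t τ (φ (projIcc a b hab τ)) := fun φ =>
    hg.add (intervalIntegral.continuous_parametric_intervalIntegral_of_continuous
      (f := fun t τ => k t τ (φ (projIcc a b hab τ))) (hkφ φ) continuous_id)
  let Ψ : C(Icc a b, X) → C(Icc a b, X) := fun φ => ⟨_, (hcont φ).comp continuous_subtype_val⟩
  have hΨ : ContractingWith (1 / 2) Ψ := by
    refine ⟨by rw [← NNReal.coe_lt_coe]; norm_num, LipschitzWith.of_dist_le_mul fun φ ψ => ?_⟩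
    refine (ContinuousMap.dist_le (by positivity)).2 fun ⟨t, ht⟩ => ?_
    have hint : ∀ φ : C(Icc a b, X),
        IntervalIntegrable (fun τ => k t τ (φ (projIcc a b hab τ))) volume a t := fun φ =>
      ((hkφ φ).comp (Continuous.prodMk_right t)).intervalIntegrable _ _
    calc dist (Ψ φ ⟨t, ht⟩) (Ψ ψ ⟨t, ht⟩)
        = ‖∫ τ in a..t, (k t τ (φ (projIcc a b hab τ)) - k t τ (ψ (projIcc a b hab τ)))‖ := by
          rw [intervalIntegral.integral_sub (hint φ) (hint ψ), dist_eq_norm]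
          exact congrArg norm (add_sub_add_left_eq_sub _ _ _)
      _ ≤ ∫ τ in a..t, κ t τ * dist φ ψ := by
          refine intervalIntegral.norm_integral_le_of_norm_le ht.1
            (Eventually.of_forall fun τ hτ => (hLip t ht τ ⟨hτ.1.le, hτ.2⟩ _ _).trans ?_)
            (((hκ t).mul continuous_const).intervalIntegrable _ _)
          rw [← dist_eq_norm]
          exact mul_le_mul_of_nonneg_left (ContinuousMap.dist_apply_le_dist _) (hκ_nonneg t τ)
      _ ≤ (1 / 2 : NNReal) * dist φ ψ := by
          rw [intervalIntegral.integral_mul_const]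
          exact mul_le_mul_of_nonneg_right ((hκ_int t ht).trans (by norm_num)) dist_nonneg
  have hfix := hΨ.fixedPoint_isFixedPt
  set φ := ContractingWith.fixedPoint Ψ hΨ
  refine ⟨fun t => φ (projIcc a b hab t), φ.continuous.comp continuous_projIcc, fun t ht => ?_⟩
  calc φ (projIcc a b hab t) = φ ⟨t, ht⟩ := by rw [projIcc_of_mem hab ht]
    _ = Ψ φ ⟨t, ht⟩ := (DFunLike.congr_fun hfix ⟨t, ht⟩).symm

theorem integral_exp_neg_mul_sub_le {l a t : ℝ} (hl : 0 < l) :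
    ∫ τ in a..t, Real.exp (-l * (t - τ)) ≤ 1 / l := by
  have hderiv : ∀ τ ∈ uIcc a t, HasDerivAt (fun τ => Real.exp (-l * (t - τ)) / l)
      (Real.exp (-l * (t - τ))) τ := fun τ _ => by
    have hlin : HasDerivAt (fun τ : ℝ => -l * (t - τ)) l τ := by
      simpa using ((hasDerivAt_id τ).const_sub t).const_mul (-l)
    simpa only [mul_div_cancel_right₀ _ hl.ne'] using hlin.exp.div_const l
  rw [intervalIntegral.integral_eq_sub_of_hasDerivAt hderiv
    (Continuous.intervalIntegrable (by fun_prop) _ _), sub_self, mul_zero, Real.exp_zero]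
  exact sub_le_self _ (by positivity)

theorem exists_volterra_solution {a b : ℝ} (hab : a ≤ b) {L : ℝ} (hL : 0 ≤ L) {g : ℝ → X}
    (hg : Continuous g) {k : ℝ → ℝ → X → X}
    (hk : Continuous fun p : ℝ × ℝ × X => k p.1 p.2.1 p.2.2)
    (hLip : ∀ t ∈ Icc a b, ∀ τ ∈ Icc a t, ∀ x y, ‖k t τ x - k t τ y‖ ≤ L * ‖x - y‖) :
    ∃ f : ℝ → X, Continuous f ∧ ∀ t ∈ Icc a b, f t = g t + ∫ τ in a..t, k t τ (f τ) := by
  -- The substitution `f t = exp (l t) φ t` weights the Lipschitz constant by `exp (-l (t - τ))`.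
  set l : ℝ := 2 * L + 1
  have hl : 0 < l := by positivity
  have hexp : ∀ t τ : ℝ, Real.exp (-l * t) * Real.exp (l * τ) = Real.exp (-l * (t - τ)) :=
    fun t τ => by rw [← Real.exp_add]; ring_nf
  obtain ⟨φ, hφ, hφ_eq⟩ := exists_volterra_solution_of_integral_le_half hab
    (g := fun t => Real.exp (-l * t) • g t)
    (k := fun t τ x => Real.exp (-l * t) • k t τ (Real.exp (l * τ) • x))
    (κ := fun t τ => L * Real.exp (-l * (t - τ))) (by fun_prop)
    (Continuous.smul (by fun_prop) (hk.comp (g := fun p : ℝ × ℝ × X => k p.1 p.2.1 p.2.2)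
      (f := fun p : ℝ × ℝ × X => (p.1, p.2.1, Real.exp (l * p.2.1) • p.2.2)) (by fun_prop)))
    (fun t => by fun_prop) (fun t τ => by positivity)
    (fun t _ => by
      rw [intervalIntegral.integral_const_mul]
      calc L * ∫ τ in a..t, Real.exp (-l * (t - τ)) ≤ L * (1 / l) := by
            gcongr; exact integral_exp_neg_mul_sub_le hl
        _ ≤ 1 / 2 := by rw [mul_one_div, div_le_div_iff₀ hl two_pos]; simp only [l]; linarith)
    (fun t ht τ hτ x y => by
      rw [← smul_sub, norm_smul, Real.norm_eq_abs, Real.abs_exp, ← hexp]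
      calc Real.exp (-l * t) * ‖k t τ (Real.exp (l * τ) • x) - k t τ (Real.exp (l * τ) • y)‖
          ≤ Real.exp (-l * t) * (L * ‖Real.exp (l * τ) • x - Real.exp (l * τ) • y‖) := by
            gcongr; exact hLip t ht τ hτ _ _
        _ = L * (Real.exp (-l * t) * Real.exp (l * τ)) * ‖x - y‖ := by
            rw [← smul_sub, norm_smul, Real.norm_eq_abs, Real.abs_exp]; ring)
  refine ⟨fun t => Real.exp (l * t) • φ t, by fun_prop, fun t ht => ?_⟩
  have hinv : Real.exp (l * t) * Real.exp (-l * t) = 1 := by rw [← Real.exp_add]; simp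
  simp only [hφ_eq t ht, intervalIntegral.integral_smul, ← smul_add, smul_smul, hinv, one_smul]

theorem exists_volterra_solution_backward {a b : ℝ} (hab : a ≤ b) {L : ℝ} (hL : 0 ≤ L)
    {g : ℝ → X} (hg : Continuous g) {k : ℝ → ℝ → X → X}
    (hk : Continuous fun p : ℝ × ℝ × X => k p.1 p.2.1 p.2.2)
    (hLip : ∀ t ∈ Icc a b, ∀ τ ∈ Icc t b, ∀ x y, ‖k t τ x - k t τ y‖ ≤ L * ‖x - y‖) :
    ∃ f : ℝ → X, Continuous f ∧ ∀ t ∈ Icc a b, f t = g t + ∫ τ in t..b, k t τ (f τ) := by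
  obtain ⟨f, hf, hf_eq⟩ := exists_volterra_solution (neg_le_neg hab) hL
    (g := fun s => g (-s)) (k := fun s τ x => k (-s) (-τ) x) (by fun_prop)
    (hk.comp (g := fun p : ℝ × ℝ × X => k p.1 p.2.1 p.2.2)
      (f := fun p : ℝ × ℝ × X => (-p.1, -p.2.1, p.2.2)) (by fun_prop))
    (fun s hs τ hτ => hLip (-s) ⟨le_neg.2 hs.2, neg_le.2 hs.1⟩ (-τ)
      ⟨neg_le_neg hτ.2, neg_le.2 hτ.1⟩)
  refine ⟨fun t => f (-t), by fun_prop, fun t ht => ?_⟩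
  have hrefl := intervalIntegral.integral_comp_neg (a := t) (b := b) fun τ => k t (-τ) (f τ)
  simp only [neg_neg] at hrefl
  simp only [hf_eq (-t) ⟨neg_le_neg ht.2, neg_le_neg ht.1⟩, neg_neg, hrefl]

end Volterra

section StrongContinuity

variable {X : Type*} [NormedAddCommGroup X] [NormedSpace ℝ X]

theorem continuous_apply_of_dense {F : ℝ → X →L[ℝ] X} {V : Submodule ℝ X}
    (hV : V.topologicalClosure = ⊤)
    (hbdd : ∀ t, ∃ u ∈ 𝓝 t, ∃ M, ∀ s ∈ u, ‖F s‖ ≤ M)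
    (hF : ∀ x ∈ V, Continuous fun t => F t x) (x : X) : Continuous fun t => F t x := by
  refine continuous_of_locally_uniform_approx_of_continuousAt fun t u hu => ?_
  obtain ⟨s, hs, M, hM⟩ := hbdd t
  obtain ⟨ε, hε, hεu⟩ := Metric.mem_uniformity_dist.1 hu
  have hM0 : 0 ≤ M := (norm_nonneg _).trans (hM t (mem_of_mem_nhds hs))
  have hx : x ∈ closure (V : Set X) := by
    rw [← Submodule.topologicalClosure_coe, hV]; trivial
  obtain ⟨y, hyV, hxy⟩ := Metric.mem_closure_iff.1 hx (ε / (M + 1)) (by positivity)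
  refine ⟨s, hs, fun t => F t y, (hF y hyV).continuousAt, fun τ hτ => hεu ?_⟩
  calc dist (F τ x) (F τ y) = ‖F τ (x - y)‖ := by rw [dist_eq_norm, map_sub]
    _ ≤ M * ‖x - y‖ := (F τ).le_of_opNorm_le (hM τ hτ) _
    _ ≤ (M + 1) * dist x y := by rw [dist_eq_norm]; gcongr; exact le_add_of_nonneg_right zero_le_one
    _ < ε := (lt_div_iff₀' (by positivity)).1 hxy

variable [CompleteSpace X]

theorem exists_norm_le_of_forall_continuousOn {F : ℝ → X →L[ℝ] X} {s : Set ℝ} (hs : IsCompact s)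
    (hF : ∀ x, ContinuousOn (fun t => F t x) s) : ∃ M, 0 ≤ M ∧ ∀ t ∈ s, ‖F t‖ ≤ M := by
  obtain ⟨C, hC⟩ := banach_steinhaus (g := fun t : s => F t) fun x => by
    obtain ⟨C, hC⟩ := hs.exists_bound_of_continuousOn (hF x)
    exact ⟨C, fun t => hC t t.2⟩
  exact ⟨max C 0, le_max_right _ _, fun t ht => (hC ⟨t, ht⟩).trans (le_max_left _ _)⟩

theorem continuous_apply_of_forall_continuous {F : ℝ → X →L[ℝ] X}
    (hF : ∀ x, Continuous fun t => F t x) : Continuous fun p : ℝ × X => F p.1 p.2 := by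
  refine continuous_iff_continuousAt.2 fun ⟨t, x⟩ => tendsto_iff_norm_sub_tendsto_zero.2 ?_
  obtain ⟨M, -, hM⟩ := exists_norm_le_of_forall_continuousOn
    (isCompact_Icc (a := t - 1) (b := t + 1)) fun x => (hF x).continuousOn
  have hbound : ∀ᶠ p : ℝ × X in 𝓝 (t, x),
      ‖F p.1 p.2 - F t x‖ ≤ M * ‖p.2 - x‖ + ‖F p.1 x - F t x‖ := by
    filter_upwards [continuous_fst.continuousAt.eventually
      (Icc_mem_nhds (sub_one_lt t) (lt_add_one t))] with p hp
    calc ‖F p.1 p.2 - F t x‖ = ‖F p.1 (p.2 - x) + (F p.1 x - F t x)‖ := by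
          rw [map_sub, sub_add_sub_cancel]
      _ ≤ ‖F p.1 (p.2 - x)‖ + ‖F p.1 x - F t x‖ := norm_add_le _ _
      _ ≤ M * ‖p.2 - x‖ + ‖F p.1 x - F t x‖ := by
          gcongr; exact (F p.1).le_of_opNorm_le (hM _ hp) _
  have hlim : Continuous fun p : ℝ × X => M * ‖p.2 - x‖ + ‖F p.1 x - F t x‖ := by
    have := (hF x).comp (continuous_fst (X := ℝ) (Y := X))
    simp only [Function.comp_def] at this
    fun_prop
  exact squeeze_zero' (Eventually.of_forall fun _ => norm_nonneg _) hbound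
    (by simpa using hlim.tendsto (t, x))

theorem exists_clm_eq_intervalIntegral {F : ℝ → X →L[ℝ] X} (hF : ∀ x, Continuous fun t => F t x)
    (a b : ℝ) : ∃ A : X →L[ℝ] X, ∀ x, A x = ∫ s in a..b, F s x := by
  obtain ⟨M, -, hM⟩ := exists_norm_le_of_forall_continuousOn (isCompact_uIcc (a := a) (b := b))
    fun x => (hF x).continuousOn
  have hint : ∀ x, IntervalIntegrable (fun s => F s x) volume a b := fun x =>
    (hF x).intervalIntegrable _ _
  refine ⟨LinearMap.mkContinuous
    { toFun := fun x => ∫ s in a..b, F s x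
      map_add' := fun x y => by
        simp only [map_add, intervalIntegral.integral_add (hint x) (hint y)]
      map_smul' := fun c x => by
        simp only [map_smul, intervalIntegral.integral_smul, RingHom.id_apply] }
    (M * |b - a|) fun x => ?_, fun x => rfl⟩
  calc ‖∫ s in a..b, F s x‖ ≤ M * ‖x‖ * |b - a| :=
        intervalIntegral.norm_integral_le_of_norm_le_const fun s hs =>
          (F s).le_of_opNorm_le (hM s (uIoc_subset_uIcc hs)) x
    _ = M * |b - a| * ‖x‖ := by ring

theorem continuous_of_apply_eq_intervalIntegral {F A : ℝ → X →L[ℝ] X}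
    (hF : ∀ x, Continuous fun t => F t x) {a : ℝ} (hA : ∀ t x, A t x = ∫ s in a..t, F s x) :
    Continuous A := by
  refine continuous_iff_continuousAt.2 fun t => ?_
  obtain ⟨M, hM0, hM⟩ := exists_norm_le_of_forall_continuousOn
    (isCompact_Icc (a := t - 1) (b := t + 1)) fun x => (hF x).continuousOn
  have hLip : LipschitzOnWith M.toNNReal A (Icc (t - 1) (t + 1)) := by
    refine LipschitzOnWith.of_dist_le_mul fun r hr s hs => ?_
    rw [Real.coe_toNNReal _ hM0, dist_eq_norm, Real.dist_eq]
    refine ContinuousLinearMap.opNorm_le_bound _ (by positivity) fun x => ?_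
    calc ‖(A r - A s) x‖ = ‖∫ τ in s..r, F τ x‖ := by
          rw [sub_apply, hA, hA, intervalIntegral.integral_interval_sub_left
            ((hF x).intervalIntegrable _ _) ((hF x).intervalIntegrable _ _)]
      _ ≤ M * ‖x‖ * |r - s| := intervalIntegral.norm_integral_le_of_norm_le_const fun τ hτ =>
          (F τ).le_of_opNorm_le (hM τ (uIcc_subset_Icc hs hr (uIoc_subset_uIcc hτ))) x
      _ = M * |r - s| * ‖x‖ := by ring
  exact hLip.continuousOn.continuousAt (Icc_mem_nhds (sub_one_lt t) (lt_add_one t))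

end StrongContinuity

section Primitive

variable {X : Type*} [NormedAddCommGroup X] [NormedSpace ℝ X]

theorem IsC0Semigroup.continuous_max {E : ℝ → X →L[ℝ] X} (hE : IsC0Semigroup E) (x : X) :
    Continuous fun t => E (max t 0) x :=
  (hE.continuousOn x).comp_continuous (by fun_prop) fun t => le_max_right t 0

theorem IsC0Semigroup.integral_comp_eq_sub {E : ℝ → X →L[ℝ] X} (hE : IsC0Semigroup E)
    {A : ℝ → X →L[ℝ] X} (hA : ∀ t x, A t x = ∫ s in 0..t, E (max s 0) x) {h t : ℝ} (hh : 0 ≤ h)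
    (ht : 0 ≤ t) : (A h).comp (E t) = A (t + h) - A t := by
  ext x
  have hint : ∀ c, IntervalIntegrable (fun s => E (max s 0) x) volume 0 c := fun c =>
    (hE.continuous_max x).intervalIntegrable _ _
  calc A h (E t x) = ∫ s in 0..h, E (max s 0) (E t x) := hA _ _
    _ = ∫ s in 0..h, E (max (s + t) 0) x := by
        refine intervalIntegral.integral_congr fun s hs => ?_
        rw [uIcc_of_le hh] at hs
        simp only [max_eq_left hs.1, max_eq_left (add_nonneg hs.1 ht), hE.map_add s t hs.1 ht,
          ContinuousLinearMap.comp_apply]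
    _ = ∫ s in t..(t + h), E (max s 0) x := by
        rw [intervalIntegral.integral_comp_add_right (fun s => E (max s 0) x), zero_add,
          add_comm h]
    _ = (A (t + h) - A t) x := by
        rw [sub_apply, hA, hA,
          intervalIntegral.integral_interval_sub_left (hint _) (hint _)]

theorem eq_zero_of_forall_intervalIntegral_eq_zero [CompleteSpace X] {f : ℝ → X}
    (hf : Continuous f) (h : ∀ t, 0 ≤ t → ∫ s in 0..t, f s = 0) : f 0 = 0 := by
  have hderiv : HasDerivWithinAt (fun t => ∫ s in 0..t, f s) (f 0) (Ici 0) 0 :=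
    (hf.integral_hasStrictDerivAt 0 0).hasDerivAt.hasDerivWithinAt
  exact (uniqueDiffOn_Ici 0 0 self_mem_Ici).eq_deriv _ hderiv
    ((hasDerivWithinAt_const 0 (Ici 0) 0).congr h (h 0 le_rfl))

end Primitive

/-- A strongly continuous semigroup with strongly continuous adjoint, extended by a strongly
continuous family to negative times so that convolution integrands are continuous on all of
`ℝ × ℝ`. -/
structure IsBicontinuousSemigroup {H : Type*} [NormedAddCommGroup H] [InnerProductSpace ℝ H]
    [CompleteSpace H] (S : ℝ → H →L[ℝ] H) : Prop where
  map_zero : S 0 = ContinuousLinearMap.id ℝ H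
  map_add : ∀ s t : ℝ, 0 ≤ s → 0 ≤ t → S (s + t) = (S s).comp (S t)
  continuous : ∀ x, Continuous fun t => S t x
  continuous_adjoint : ∀ x, Continuous fun t => ContinuousLinearMap.adjoint (S t) x

section AdjointSemigroup

variable {H : Type*} [NormedAddCommGroup H] [InnerProductSpace ℝ H] [CompleteSpace H]

open ContinuousLinearMap (adjoint)

protected theorem IsBicontinuousSemigroup.adjoint {S : ℝ → H →L[ℝ] H}
    (hS : IsBicontinuousSemigroup S) :
    IsBicontinuousSemigroup fun t => adjoint (S t) where
  map_zero := by rw [hS.map_zero, ContinuousLinearMap.adjoint_id]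
  map_add s t hs ht := by
    rw [add_comm, hS.map_add t s ht hs, ContinuousLinearMap.adjoint_comp]
  continuous := hS.continuous_adjoint
  continuous_adjoint x := by simpa only [ContinuousLinearMap.adjoint_adjoint] using hS.continuous x

/-- The vectors `y` with `t ↦ E(t)* y` continuous form a closed subspace. It contains the range of
the adjoint of every primitive `∫₀ʰ E`, and a vector orthogonal to all these ranges vanishes. -/
theorem IsC0Semigroup.continuous_adjoint {E : ℝ → H →L[ℝ] H} (hE : IsC0Semigroup E) (y : H) :
    Continuous fun t => adjoint (E (max t 0)) y := by
  choose A hA using exists_clm_eq_intervalIntegral hE.continuous_max 0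
  have hA_cont : Continuous A := continuous_of_apply_eq_intervalIntegral hE.continuous_max hA
  let V : Submodule ℝ H :=
    { carrier := {y | Continuous fun t => adjoint (E (max t 0)) y}
      add_mem' := fun hx hy => (hx.add hy).congr fun t => (_root_.map_add _ _ _).symm
      zero_mem' := continuous_const.congr fun t => (_root_.map_zero _).symm
      smul_mem' := fun c x hx => (hx.const_smul c).congr fun t => (map_smul _ _ _).symm }
  have hrange : ∀ h, 0 ≤ h → ∀ y, adjoint (A h) y ∈ V := fun h hh y => by
    have hcomp : ∀ t, adjoint (E (max t 0)) (adjoint (A h) y)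
        = adjoint (A (max t 0 + h) - A (max t 0)) y := fun t => by
      rw [← hE.integral_comp_eq_sub hA hh (le_max_right t 0), ContinuousLinearMap.adjoint_comp,
        ContinuousLinearMap.comp_apply]
    refine (continuous_congr hcomp).2 ?_
    have : Continuous fun t => A (max t 0 + h) - A (max t 0) :=
      (hA_cont.comp (by fun_prop)).sub (hA_cont.comp (by fun_prop))
    exact (adjoint.continuous.comp this).clm_apply continuous_const
  have hV : V.topologicalClosure = ⊤ := by
    refine (Submodule.topologicalClosure_eq_top_iff).2 ((Submodule.eq_bot_iff _).2 fun w hw => ?_)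
    have hAw : ∀ h, 0 ≤ h → ∫ s in 0..h, E (max s 0) w = 0 := fun h hh => by
      rw [← hA, ← inner_self_eq_zero (𝕜 := ℝ), ← ContinuousLinearMap.adjoint_inner_left]
      exact hw _ (hrange h hh _)
    simpa only [max_self, hE.map_zero, ContinuousLinearMap.id_apply] using
      eq_zero_of_forall_intervalIntegral_eq_zero (hE.continuous_max w) hAw
  refine continuous_apply_of_dense (F := fun t => adjoint (E (max t 0))) hV (fun t => ?_)
    (fun y hy => hy) y
  obtain ⟨M, -, hM⟩ := exists_norm_le_of_forall_continuousOn
    (isCompact_Icc (a := t - 1) (b := t + 1)) fun x => (hE.continuous_max x).continuousOn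
  exact ⟨_, Icc_mem_nhds (sub_one_lt t) (lt_add_one t), M, fun s hs => by
    rw [LinearIsometryEquiv.norm_map]; exact hM s hs⟩

theorem IsC0Semigroup.isBicontinuousSemigroup {E : ℝ → H →L[ℝ] H} (hE : IsC0Semigroup E) :
    IsBicontinuousSemigroup fun t => E (max t 0) where
  map_zero := by rw [max_self, hE.map_zero]
  map_add s t hs ht := by
    rw [max_eq_left hs, max_eq_left ht, max_eq_left (add_nonneg hs ht), hE.map_add s t hs ht]
  continuous := hE.continuous_max
  continuous_adjoint := hE.continuous_adjoint

end AdjointSemigroup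

section MildEquations

open ContinuousLinearMap (adjoint)

variable {H : Type*} [NormedAddCommGroup H] [InnerProductSpace ℝ H] [CompleteSpace H]
  {S : ℝ → H →L[ℝ] H} {a b : ℝ}

/-- `z` is a mild solution of `z' = A z + u` on `[a, b]` with `z a = x`, where `A` is the generator
of `S`; functions on `[a, b]` are encoded as continuous functions on `ℝ`. -/
structure IsMildForward (S : ℝ → H →L[ℝ] H) (a b : ℝ) (x : H) (u z : ℝ → H) : Prop where
  continuous_source : Continuous u
  continuous : Continuous z
  eq : ∀ t ∈ Icc a b, z t = S (t - a) x + ∫ τ in a..t, S (t - τ) (u τ)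

/-- `q` is a mild solution of `q' + A* q + g = 0` on `[a, b]` with `q b = y`, where `A` is the
generator of `S`; functions on `[a, b]` are encoded as continuous functions on `ℝ`. -/
structure IsMildBackward (S : ℝ → H →L[ℝ] H) (a b : ℝ) (y : H) (g q : ℝ → H) : Prop where
  continuous_source : Continuous g
  continuous : Continuous q
  eq : ∀ t ∈ Icc a b, q t = adjoint (S (b - t)) y + ∫ τ in t..b, adjoint (S (τ - t)) (g τ)

/-- `P` is a mild solution of the Lyapunov equation `P' + P A + A* P + F = 0` on `[a, b]` with
`P b = QT`, where `A` is the generator of `S`. -/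
structure IsMildLyapunov (S : ℝ → H →L[ℝ] H) (a b : ℝ) (QT : H →L[ℝ] H) (F P : ℝ → H →L[ℝ] H) :
    Prop where
  continuous_source : ∀ x, Continuous fun t => F t x
  continuous : ∀ x, Continuous fun t => P t x
  eq : ∀ x, ∀ t ∈ Icc a b, P t x = adjoint (S (b - t)) (QT (S (b - t) x))
    + ∫ τ in t..b, adjoint (S (τ - t)) (F τ (S (τ - t) x))

theorem IsMildForward.isMildBackward_comp_neg {y : H} {g z : ℝ → H}
    (hz : IsMildForward (fun t => adjoint (S t)) a b y g z) :
    IsMildBackward S (-b) (-a) y (fun t => g (-t)) fun t => z (-t) where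
  continuous_source := hz.continuous_source.comp continuous_neg
  continuous := hz.continuous.comp continuous_neg
  eq t ht := by
    have hrefl := intervalIntegral.integral_comp_neg (a := t) (b := -a)
      fun τ => adjoint (S (-t - τ)) (g τ)
    simp only [neg_neg, sub_neg_eq_add, neg_add_eq_sub] at hrefl
    rw [hz.eq (-t) ⟨le_neg.2 ht.2, neg_le.2 ht.1⟩, hrefl, neg_sub_comm]

namespace IsBicontinuousSemigroup

theorem continuous_comp (hS : IsBicontinuousSemigroup S) {Y : Type*} [TopologicalSpace Y]
    {f : Y → ℝ} {g : Y → H} (hf : Continuous f) (hg : Continuous g) :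
    Continuous fun p => S (f p) (g p) :=
  (continuous_apply_of_forall_continuous hS.continuous).comp (hf.prodMk hg)

theorem continuous_adjoint_comp (hS : IsBicontinuousSemigroup S) {Y : Type*} [TopologicalSpace Y]
    {f : Y → ℝ} {g : Y → H} (hf : Continuous f) (hg : Continuous g) :
    Continuous fun p => adjoint (S (f p)) (g p) :=
  hS.adjoint.continuous_comp hf hg

theorem exists_norm_le (hS : IsBicontinuousSemigroup S) (T : ℝ) :
    ∃ M, 0 ≤ M ∧ ∀ t ∈ Icc 0 T, ‖S t‖ ≤ M :=
  exists_norm_le_of_forall_continuousOn isCompact_Icc fun x => (hS.continuous x).continuousOn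

theorem apply_apply (hS : IsBicontinuousSemigroup S) {s t u : ℝ} (hst : s ≤ t) (htu : t ≤ u)
    (x : H) : S (u - t) (S (t - s) x) = S (u - s) x := by
  rw [← ContinuousLinearMap.comp_apply, ← hS.map_add _ _ (sub_nonneg.2 htu) (sub_nonneg.2 hst),
    sub_add_sub_cancel]

theorem exists_isMildForward (hS : IsBicontinuousSemigroup S) (hab : a ≤ b) (x : H)
    {K : ℝ → H →L[ℝ] H} (hK : ∀ x, Continuous fun t => K t x) {f : ℝ → H} (hf : Continuous f) :
    ∃ z, IsMildForward S a b x (fun t => K t (z t) + f t) z := by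
  have hK' := continuous_apply_of_forall_continuous hK
  have hS' := hS.continuous_comp (Y := ℝ × ℝ × H) (f := fun p => p.1 - p.2.1)
    (g := fun p => K p.2.1 p.2.2 + f p.2.1) (by fun_prop)
    ((hK'.comp continuous_snd).add (hf.comp (by fun_prop)))
  obtain ⟨M, hM0, hM⟩ := hS.exists_norm_le (b - a)
  obtain ⟨C, hC0, hC⟩ := exists_norm_le_of_forall_continuousOn (isCompact_Icc (a := a) (b := b))
    fun x => (hK x).continuousOn
  obtain ⟨z, hz, hz_eq⟩ := exists_volterra_solution hab (mul_nonneg hM0 hC0)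
    (g := fun t => S (t - a) x) (k := fun t τ z => S (t - τ) (K τ z + f τ))
    (hS.continuous_comp (by fun_prop) continuous_const) hS' fun t ht τ hτ x y => by
      rw [← map_sub, add_sub_add_right_eq_sub, ← map_sub, mul_assoc]
      exact ContinuousLinearMap.le_of_opNorm_le_of_le _
        (hM _ ⟨sub_nonneg.2 hτ.2, by linarith [hτ.1, ht.2]⟩)
        ((K τ).le_of_opNorm_le (hC τ ⟨hτ.1, hτ.2.trans ht.2⟩) _)
  exact ⟨z, (hK'.comp (continuous_id.prodMk hz)).add hf, hz, hz_eq⟩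

theorem exists_isMildBackward (hS : IsBicontinuousSemigroup S) (hab : a ≤ b) (y : H)
    {K : ℝ → H →L[ℝ] H} (hK : ∀ x, Continuous fun t => K t x) {f : ℝ → H} (hf : Continuous f) :
    ∃ q, IsMildBackward S a b y (fun t => K t (q t) + f t) q := by
  obtain ⟨z, hz⟩ := hS.adjoint.exists_isMildForward (neg_le_neg hab) y
    (K := fun s => K (-s)) (fun x => (hK x).comp continuous_neg)
    (f := fun s => f (-s)) (hf.comp continuous_neg)
  have hq := hz.isMildBackward_comp_neg
  simp only [neg_neg] at hq
  exact ⟨_, hq⟩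

theorem exists_isMildLyapunov (hS : IsBicontinuousSemigroup S) (a b : ℝ) (QT : H →L[ℝ] H)
    {F : ℝ → H →L[ℝ] H} (hF : ∀ x, Continuous fun t => F t x) :
    ∃ P, IsMildLyapunov S a b QT F P := by
  have hsource : ∀ x, Continuous fun p : ℝ × ℝ =>
      adjoint (S (p.2 - p.1)) (F p.2 (S (p.2 - p.1) x)) := fun x =>
    hS.continuous_adjoint_comp (continuous_snd.sub continuous_fst)
      ((continuous_apply_of_forall_continuous hF).comp (continuous_snd.prodMk
        (hS.continuous_comp (continuous_snd.sub continuous_fst) continuous_const)))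
  have hslice : ∀ t x, Continuous fun τ => (adjoint (S (τ - t)) ∘L F τ ∘L S (τ - t)) x :=
    fun t x => by
      simp only [ContinuousLinearMap.comp_apply]
      exact hS.continuous_adjoint_comp (by fun_prop)
        ((continuous_apply_of_forall_continuous hF).comp (continuous_id.prodMk
          (hS.continuous_comp (by fun_prop) continuous_const)))
  choose A hA using fun t => exists_clm_eq_intervalIntegral (hslice t) t b
  refine ⟨fun t => adjoint (S (b - t)) ∘L QT ∘L S (b - t) + A t, hF, fun x => ?_, fun x t _ => ?_⟩
  · simp only [add_apply, hA, ContinuousLinearMap.comp_apply]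
    refine (hS.continuous_adjoint_comp (by fun_prop) (QT.continuous.comp
      (hS.continuous_comp (by fun_prop) continuous_const))).add
        (continuous_intervalIntegral_left
          (f := fun t τ => adjoint (S (τ - t)) (F τ (S (τ - t) x))) (hsource x) b)
  · simp only [add_apply, hA, ContinuousLinearMap.comp_apply]

end IsBicontinuousSemigroup

theorem intervalIntegral_clm_apply (L : H →L[ℝ] H) {f : ℝ → H} (hf : Continuous f) (s t : ℝ) :
    L (∫ τ in s..t, f τ) = ∫ τ in s..t, L (f τ) :=
  (L.intervalIntegral_comp_comm (hf.intervalIntegrable _ _)).symm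

theorem inner_intervalIntegral (x : H) {f : ℝ → H} (hf : Continuous f) (s t : ℝ) :
    ⟪x, ∫ τ in s..t, f τ⟫_ℝ = ∫ τ in s..t, ⟪x, f τ⟫_ℝ :=
  ((innerSL ℝ x).intervalIntegral_comp_comm (hf.intervalIntegrable _ _)).symm

theorem intervalIntegral_inner {f : ℝ → H} (hf : Continuous f) (x : H) (s t : ℝ) :
    ⟪∫ τ in s..t, f τ, x⟫_ℝ = ∫ τ in s..t, ⟪f τ, x⟫_ℝ := by
  simp only [real_inner_comm x, inner_intervalIntegral x hf]

namespace IsMildForward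

variable {x x' : H} {u u' z z' : ℝ → H}

protected theorem sub (hS : IsBicontinuousSemigroup S) (h : IsMildForward S a b x u z)
    (h' : IsMildForward S a b x' u' z') : IsMildForward S a b (x - x') (u - u') (z - z') where
  continuous_source := h.continuous_source.sub h'.continuous_source
  continuous := h.continuous.sub h'.continuous
  eq t ht := by
    have hint : ∀ {u}, Continuous u →
        IntervalIntegrable (fun τ => S (t - τ) (u τ)) volume a t := fun hu =>
      (hS.continuous_comp (by fun_prop) hu).intervalIntegrable _ _
    simp only [Pi.sub_apply, h.eq t ht, h'.eq t ht, map_sub, intervalIntegral.integral_sub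
      (hint h.continuous_source) (hint h'.continuous_source)]
    abel

theorem apply_left (hS : IsBicontinuousSemigroup S) (h : IsMildForward S a b x u z)
    (hab : a ≤ b) : z a = x := by
  rw [h.eq a (left_mem_Icc.2 hab), intervalIntegral.integral_same, add_zero, sub_self, hS.map_zero,
    ContinuousLinearMap.id_apply]

theorem restart (hS : IsBicontinuousSemigroup S) (h : IsMildForward S a b x u z) {t : ℝ}
    (ht : t ∈ Icc a b) : IsMildForward S t b (z t) u z where
  continuous_source := h.continuous_source
  continuous := h.continuous
  eq s hs := by
    have hcont : ∀ r, Continuous fun τ => S (r - τ) (u τ) := fun r =>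
      hS.continuous_comp (by fun_prop) h.continuous_source
    have hint : ∀ r c d, IntervalIntegrable (fun τ => S (r - τ) (u τ)) volume c d := fun r c d =>
      (hcont r).intervalIntegrable c d
    have hcongr : ∫ τ in a..t, S (s - t) (S (t - τ) (u τ)) = ∫ τ in a..t, S (s - τ) (u τ) :=
      intervalIntegral.integral_congr fun τ hτ => by
        rw [uIcc_of_le ht.1] at hτ
        exact hS.apply_apply hτ.2 hs.1 _
    rw [h.eq s ⟨ht.1.trans hs.1, hs.2⟩, h.eq t ht, map_add, hS.apply_apply ht.1 hs.1,
      intervalIntegral_clm_apply _ (hcont t), hcongr, add_assoc,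
      intervalIntegral.integral_add_adjacent_intervals (hint _ _ _) (hint _ _ _)]

theorem inner_eq (hS : IsBicontinuousSemigroup S) (h : IsMildForward S a b x u z) {t : ℝ}
    (ht : t ∈ Icc a b) (w : H) :
    ⟪w, z t⟫_ℝ = ⟪w, S (t - a) x⟫_ℝ + ∫ τ in a..t, ⟪w, S (t - τ) (u τ)⟫_ℝ := by
  rw [h.eq t ht, inner_add_right, inner_intervalIntegral w
    (hS.continuous_comp (by fun_prop) h.continuous_source)]

theorem integral_inner_eq (hS : IsBicontinuousSemigroup S) (h : IsMildForward S a b x u z)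
    (hab : a ≤ b) {g : ℝ → H} (hg : Continuous g) :
    ∫ τ in a..b, ⟪g τ, z τ⟫_ℝ = (∫ τ in a..b, ⟪g τ, S (τ - a) x⟫_ℝ)
      + ∫ t in a..b, ∫ τ in t..b, ⟪g τ, S (τ - t) (u t)⟫_ℝ := by
  have hcont : Continuous fun p : ℝ × ℝ => ⟪g p.1, S (p.1 - p.2) (u p.2)⟫_ℝ :=
    (hg.comp continuous_fst).inner
      (hS.continuous_comp (by fun_prop) (h.continuous_source.comp continuous_snd))
  rw [← intervalIntegral_triangle_swap_of_continuous hab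
      (f := fun τ t => ⟪g τ, S (τ - t) (u t)⟫_ℝ) hcont,
    ← intervalIntegral.integral_add
      ((hg.inner (hS.continuous_comp (by fun_prop) continuous_const)).intervalIntegrable _ _)
      ((intervalIntegral.continuous_parametric_intervalIntegral_of_continuous
        (f := fun τ t => ⟪g τ, S (τ - t) (u t)⟫_ℝ) hcont continuous_id').intervalIntegrable _ _)]
  refine intervalIntegral.integral_congr fun τ hτ => ?_
  rw [uIcc_of_le hab] at hτ
  exact h.inner_eq hS hτ (g τ)

end IsMildForward

namespace IsMildBackward

variable {y y' : H} {g g' q q' : ℝ → H}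

protected theorem add (hS : IsBicontinuousSemigroup S) (h : IsMildBackward S a b y g q)
    (h' : IsMildBackward S a b y' g' q') : IsMildBackward S a b (y + y') (g + g') (q + q') where
  continuous_source := h.continuous_source.add h'.continuous_source
  continuous := h.continuous.add h'.continuous
  eq t ht := by
    have hint : ∀ {g}, Continuous g →
        IntervalIntegrable (fun τ => adjoint (S (τ - t)) (g τ)) volume t b := fun hg =>
      (hS.continuous_adjoint_comp (by fun_prop) hg).intervalIntegrable _ _
    simp only [Pi.add_apply, h.eq t ht, h'.eq t ht, map_add, intervalIntegral.integral_add
      (hint h.continuous_source) (hint h'.continuous_source)]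
    abel

protected theorem neg (h : IsMildBackward S a b y g q) : IsMildBackward S a b (-y) (-g) (-q) where
  continuous_source := h.continuous_source.neg
  continuous := h.continuous.neg
  eq t ht := by
    simp only [Pi.neg_apply, h.eq t ht, map_neg, intervalIntegral.integral_neg, neg_add]

protected theorem sub (hS : IsBicontinuousSemigroup S) (h : IsMildBackward S a b y g q)
    (h' : IsMildBackward S a b y' g' q') : IsMildBackward S a b (y - y') (g - g') (q - q') := by
  simpa only [sub_eq_add_neg] using h.add hS h'.neg

theorem inner_eq (hS : IsBicontinuousSemigroup S) (h : IsMildBackward S a b y g q) {t : ℝ}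
    (ht : t ∈ Icc a b) (w : H) :
    ⟪q t, w⟫_ℝ = ⟪y, S (b - t) w⟫_ℝ + ∫ τ in t..b, ⟪g τ, S (τ - t) w⟫_ℝ := by
  rw [h.eq t ht, inner_add_left, intervalIntegral_inner
    (hS.continuous_adjoint_comp (by fun_prop) h.continuous_source)]
  simp only [ContinuousLinearMap.adjoint_inner_left]

theorem integral_inner_eq (hS : IsBicontinuousSemigroup S) (h : IsMildBackward S a b y g q)
    (hab : a ≤ b) {u : ℝ → H} (hu : Continuous u) :
    ∫ t in a..b, ⟪q t, u t⟫_ℝ = (∫ t in a..b, ⟪y, S (b - t) (u t)⟫_ℝ)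
      + ∫ t in a..b, ∫ τ in t..b, ⟪g τ, S (τ - t) (u t)⟫_ℝ := by
  have hcont : Continuous fun p : ℝ × ℝ => ⟪g p.2, S (p.2 - p.1) (u p.1)⟫_ℝ :=
    (h.continuous_source.comp continuous_snd).inner
      (hS.continuous_comp (by fun_prop) (hu.comp continuous_fst))
  rw [← intervalIntegral.integral_add
      ((continuous_const.inner (hS.continuous_comp (by fun_prop) hu)).intervalIntegrable _ _)
      ((continuous_intervalIntegral_left
        (f := fun t τ => ⟪g τ, S (τ - t) (u t)⟫_ℝ) hcont b).intervalIntegrable _ _)]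
  refine intervalIntegral.integral_congr fun t ht => ?_
  rw [uIcc_of_le hab] at ht
  exact h.inner_eq hS ht (u t)

theorem of_inner_eq (hS : IsBicontinuousSemigroup S) (hg : Continuous g) (hq : Continuous q)
    (h : ∀ t ∈ Icc a b, ∀ w,
      ⟪q t, w⟫_ℝ = ⟪y, S (b - t) w⟫_ℝ + ∫ τ in t..b, ⟪g τ, S (τ - t) w⟫_ℝ) :
    IsMildBackward S a b y g q where
  continuous_source := hg
  continuous := hq
  eq t ht := ext_inner_right ℝ fun w => by
    rw [h t ht, inner_add_left, intervalIntegral_inner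
      (hS.continuous_adjoint_comp (by fun_prop) hg)]
    simp only [ContinuousLinearMap.adjoint_inner_left]

theorem duality (hS : IsBicontinuousSemigroup S) (hab : a ≤ b) (hq : IsMildBackward S a b y g q)
    {x : H} {u z : ℝ → H} (hz : IsMildForward S a b x u z) :
    ⟪q a, x⟫_ℝ + ∫ t in a..b, ⟪q t, u t⟫_ℝ = ⟪y, z b⟫_ℝ + ∫ t in a..b, ⟪g t, z t⟫_ℝ := by
  rw [hq.inner_eq hS (left_mem_Icc.2 hab), hq.integral_inner_eq hS hab hz.continuous_source,
    hz.inner_eq hS (right_mem_Icc.2 hab), hz.integral_inner_eq hS hab hq.continuous_source]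
  abel

end IsMildBackward

namespace IsMildLyapunov

variable {QT : H →L[ℝ] H} {F P : ℝ → H →L[ℝ] H}

theorem continuous_apply_comp (h : IsMildLyapunov S a b QT F P) {f : ℝ → H} (hf : Continuous f) :
    Continuous fun t => P t (f t) :=
  (continuous_apply_of_forall_continuous h.continuous).comp (continuous_id.prodMk hf)

theorem continuous_source_apply_comp (h : IsMildLyapunov S a b QT F P) {f : ℝ → H}
    (hf : Continuous f) : Continuous fun t => F t (f t) :=
  (continuous_apply_of_forall_continuous h.continuous_source).comp (continuous_id.prodMk hf)

theorem mono_left (h : IsMildLyapunov S a b QT F P) {t : ℝ} (ht : a ≤ t) :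
    IsMildLyapunov S t b QT F P :=
  ⟨h.continuous_source, h.continuous, fun x s hs => h.eq x s ⟨ht.trans hs.1, hs.2⟩⟩

theorem congr_source (h : IsMildLyapunov S a b QT F P) {F' : ℝ → H →L[ℝ] H}
    (hF' : ∀ x, Continuous fun t => F' t x) (hFF' : EqOn F F' (Icc a b)) :
    IsMildLyapunov S a b QT F' P where
  continuous_source := hF'
  continuous := h.continuous
  eq x t ht := by
    rw [h.eq x t ht]
    refine congrArg _ (intervalIntegral.integral_congr fun τ hτ => ?_)
    rw [uIcc_of_le ht.2] at hτ
    simp only [hFF' ⟨ht.1.trans hτ.1, hτ.2⟩]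

theorem inner_eq (hS : IsBicontinuousSemigroup S) (h : IsMildLyapunov S a b QT F P) {t : ℝ}
    (ht : t ∈ Icc a b) (x w : H) :
    ⟪P t x, w⟫_ℝ = ⟪QT (S (b - t) x), S (b - t) w⟫_ℝ
      + ∫ τ in t..b, ⟪F τ (S (τ - t) x), S (τ - t) w⟫_ℝ := by
  rw [h.eq x t ht, inner_add_left, intervalIntegral_inner (hS.continuous_adjoint_comp (by fun_prop)
    (h.continuous_source_apply_comp (hS.continuous_comp (by fun_prop) continuous_const)))]
  simp only [ContinuousLinearMap.adjoint_inner_left]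

theorem isSymmetric (hS : IsBicontinuousSemigroup S) (h : IsMildLyapunov S a b QT F P)
    (hQT : QT.IsSymmetric) (hF : ∀ t ∈ Icc a b, (F t).IsSymmetric) {t : ℝ} (ht : t ∈ Icc a b) :
    (P t).IsSymmetric := fun x w => by
  have hQT_symm : ⟪QT (S (b - t) x), S (b - t) w⟫_ℝ = ⟪QT (S (b - t) w), S (b - t) x⟫_ℝ :=
    (hQT _ _).trans (real_inner_comm _ _)
  have hF_symm : ∫ τ in t..b, ⟪F τ (S (τ - t) x), S (τ - t) w⟫_ℝ
      = ∫ τ in t..b, ⟪F τ (S (τ - t) w), S (τ - t) x⟫_ℝ :=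
    intervalIntegral.integral_congr fun τ hτ => by
      rw [uIcc_of_le ht.2] at hτ
      exact (hF τ ⟨ht.1.trans hτ.1, hτ.2⟩ _ _).trans (real_inner_comm _ _)
  calc ⟪P t x, w⟫_ℝ = ⟪P t w, x⟫_ℝ := by
        rw [h.inner_eq hS ht, h.inner_eq hS ht, hQT_symm, hF_symm]
    _ = ⟪x, P t w⟫_ℝ := real_inner_comm _ _

theorem isMildBackward_apply_semigroup (hS : IsBicontinuousSemigroup S)
    (h : IsMildLyapunov S a b QT F P) {t : ℝ} (ht : t ∈ Icc a b) (w : H) :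
    IsMildBackward S t b (QT (S (b - t) w)) (fun τ => F τ (S (τ - t) w))
      fun τ => P τ (S (τ - t) w) where
  continuous_source :=
    h.continuous_source_apply_comp (hS.continuous_comp (by fun_prop) continuous_const)
  continuous := h.continuous_apply_comp (hS.continuous_comp (by fun_prop) continuous_const)
  eq s hs := by
    have hcongr : ∫ τ in s..b, adjoint (S (τ - s)) (F τ (S (τ - s) (S (s - t) w)))
        = ∫ τ in s..b, adjoint (S (τ - s)) (F τ (S (τ - t) w)) :=
      intervalIntegral.integral_congr fun τ hτ => by
        rw [uIcc_of_le hs.2] at hτ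
        exact congrArg (fun x => adjoint (S (τ - s)) (F τ x)) (hS.apply_apply hs.1 hτ.1 w)
    rw [h.eq _ s ⟨ht.1.trans hs.1, hs.2⟩, hS.apply_apply hs.1 hs.2, hcongr]

/-- Obtained by pairing `z` with the costate `τ ↦ P(τ) S(τ - t) w` for every `w`. -/
theorem isMildBackward_apply (hS : IsBicontinuousSemigroup S) (h : IsMildLyapunov S a b QT F P)
    (hQT : QT.IsSymmetric) (hF : ∀ t ∈ Icc a b, (F t).IsSymmetric) {x : H} {u z : ℝ → H}
    (hz : IsMildForward S a b x u z) :
    IsMildBackward S a b (QT (z b)) (fun t => F t (z t) - P t (u t)) fun t => P t (z t) := by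
  have hFz := h.continuous_source_apply_comp hz.continuous
  have hPu := h.continuous_apply_comp hz.continuous_source
  refine .of_inner_eq hS (hFz.sub hPu) (h.continuous_apply_comp hz.continuous) fun t ht w => ?_
  have hSw : Continuous fun τ => S (τ - t) w := hS.continuous_comp (by fun_prop) continuous_const
  have hdual := (h.isMildBackward_apply_semigroup hS ht w).duality hS ht.2 (hz.restart hS ht)
  have hPu_symm : ∫ τ in t..b, ⟪P τ (S (τ - t) w), u τ⟫_ℝ
      = ∫ τ in t..b, ⟪P τ (u τ), S (τ - t) w⟫_ℝ :=
    intervalIntegral.integral_congr fun τ hτ => by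
      rw [uIcc_of_le ht.2] at hτ
      exact ((h.isSymmetric hS hQT hF ⟨ht.1.trans hτ.1, hτ.2⟩) _ _).trans (real_inner_comm _ _)
  have hFz_symm : ∫ τ in t..b, ⟪F τ (S (τ - t) w), z τ⟫_ℝ
      = ∫ τ in t..b, ⟪F τ (z τ), S (τ - t) w⟫_ℝ :=
    intervalIntegral.integral_congr fun τ hτ => by
      rw [uIcc_of_le ht.2] at hτ
      exact (hF τ ⟨ht.1.trans hτ.1, hτ.2⟩ _ _).trans (real_inner_comm _ _)
  have hPt_symm : ⟪P t w, z t⟫_ℝ = ⟪P t (z t), w⟫_ℝ :=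
    (h.isSymmetric hS hQT hF ht _ _).trans (real_inner_comm _ _)
  have hQT_symm : ⟪QT (S (b - t) w), z b⟫_ℝ = ⟪QT (z b), S (b - t) w⟫_ℝ :=
    (hQT _ _).trans (real_inner_comm _ _)
  rw [hPu_symm, hFz_symm, sub_self, hS.map_zero, ContinuousLinearMap.id_apply, hPt_symm,
    hQT_symm] at hdual
  simp only [inner_sub_left]
  rw [intervalIntegral.integral_sub ((hFz.inner hSw).intervalIntegrable _ _)
    ((hPu.inner hSw).intervalIntegrable _ _)]
  linarith

end IsMildLyapunov

end MildEquations

section BallRetraction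

variable {X : Type*} [NormedAddCommGroup X] [NormedSpace ℝ X]

/-- The radial retraction of a normed space onto its closed ball of radius `K > 0`; it truncates
the quadratic term of the Riccati equation. -/
noncomputable def ballRetraction (K : ℝ) (x : X) : X := (K / max K ‖x‖) • x

variable {K : ℝ}

theorem ballRetraction_eq_self (hK : 0 < K) {x : X} (hx : ‖x‖ ≤ K) : ballRetraction K x = x := by
  rw [ballRetraction, max_eq_left hx, div_self hK.ne', one_smul]

theorem exists_ballRetraction_eq_smul (hK : 0 < K) (x : X) :
    ∃ θ ∈ Icc (0 : ℝ) 1, ballRetraction K x = θ • x :=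
  ⟨_, ⟨by positivity, div_le_one_of_le₀ (le_max_left _ _) (by positivity)⟩, rfl⟩

theorem norm_ballRetraction_le (hK : 0 < K) (x : X) : ‖ballRetraction K x‖ ≤ K := by
  have hmax : 0 < max K ‖x‖ := lt_max_of_lt_left hK
  rw [ballRetraction, norm_smul, Real.norm_of_nonneg (by positivity), div_mul_eq_mul_div,
    div_le_iff₀ hmax]
  exact mul_le_mul_of_nonneg_left (le_max_right _ _) hK.le

theorem norm_ballRetraction_sub_le (hK : 0 < K) (x y : X) :
    ‖ballRetraction K x - ballRetraction K y‖ ≤ 2 * ‖x - y‖ := by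
  set m := max K ‖x‖
  set n := max K ‖y‖
  have hm : 0 < m := lt_max_of_lt_left hK
  have hn : 0 < n := lt_max_of_lt_left hK
  have hmn : |n - m| ≤ ‖x - y‖ := by
    simpa only [m, n, max_comm K, norm_sub_rev x] using
      (abs_max_sub_max_le_abs ‖y‖ ‖x‖ K).trans (abs_norm_sub_norm_le y x)
  have hsplit : ballRetraction K x - ballRetraction K y
      = (K / m) • (x - y) + (K / m * (n - m) / n) • y := by
    have hcoeff : K / m * (n - m) / n = K / m - K / n := by field_simp
    rw [hcoeff, ballRetraction, ballRetraction]
    module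
  have hKm : K / m ≤ 1 := div_le_one_of_le₀ (le_max_left _ _) hm.le
  have hyn : ‖y‖ / n ≤ 1 := div_le_one_of_le₀ (le_max_right _ _) hn.le
  calc ‖ballRetraction K x - ballRetraction K y‖
      ≤ ‖(K / m) • (x - y)‖ + ‖(K / m * (n - m) / n) • y‖ := hsplit ▸ norm_add_le _ _
    _ = K / m * ‖x - y‖ + K / m * |n - m| * (‖y‖ / n) := by
        rw [norm_smul, norm_smul, Real.norm_of_nonneg (by positivity), Real.norm_eq_abs, abs_div,
          abs_mul, abs_of_pos hn, abs_of_pos (div_pos hK hm)]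
        ring
    _ ≤ 1 * ‖x - y‖ + 1 * ‖x - y‖ * 1 := by gcongr
    _ = 2 * ‖x - y‖ := by ring

theorem continuous_ballRetraction (hK : 0 < K) : Continuous (ballRetraction K : X → X) :=
  (LipschitzWith.of_dist_le' fun x y => by
    simpa only [dist_eq_norm] using norm_ballRetraction_sub_le hK x y).continuous

end BallRetraction

section QuadraticTerm

open InnerProductSpace (rankOne)

variable {H : Type*} [NormedAddCommGroup H] [InnerProductSpace ℝ H]

theorem norm_rankOne_self_sub_le (x y : H) :
    ‖rankOne ℝ x x - rankOne ℝ y y‖ ≤ (‖x‖ + ‖y‖) * ‖x - y‖ := by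
  have hsplit : rankOne ℝ x x - rankOne ℝ y y = rankOne ℝ x (x - y) + rankOne ℝ (x - y) y := by
    simp only [map_sub, sub_apply]
    abel
  calc ‖rankOne ℝ x x - rankOne ℝ y y‖ ≤ ‖rankOne ℝ x (x - y)‖ + ‖rankOne ℝ (x - y) y‖ :=
        hsplit ▸ norm_add_le _ _
    _ = (‖x‖ + ‖y‖) * ‖x - y‖ := by
        rw [InnerProductSpace.norm_rankOne, InnerProductSpace.norm_rankOne]
        ring

/-- The source `Q - P N P` of the Riccati equation, where `N = ⟪v, ·⟫ v`, as a function of the gain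
`x = P v`, with the quadratic term truncated at `‖x‖ = K`. -/
noncomputable def truncatedSource (Q : H →L[ℝ] H) (K : ℝ) (x : H) : H →L[ℝ] H :=
  Q - rankOne ℝ (ballRetraction K x) (ballRetraction K x)

theorem lipschitzWith_truncatedSource (Q : H →L[ℝ] H) {K : ℝ} (hK : 0 < K) :
    LipschitzWith (4 * K).toNNReal (truncatedSource Q K) :=
  LipschitzWith.of_dist_le' fun x y => by
    rw [dist_eq_norm, dist_eq_norm, norm_sub_rev x, truncatedSource, truncatedSource,
      sub_sub_sub_cancel_left]
    calc _ ≤ (‖ballRetraction K y‖ + ‖ballRetraction K x‖)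
            * ‖ballRetraction K y - ballRetraction K x‖ := norm_rankOne_self_sub_le _ _
      _ ≤ (K + K) * (2 * ‖y - x‖) := mul_le_mul
          (add_le_add (norm_ballRetraction_le hK y) (norm_ballRetraction_le hK x))
          (norm_ballRetraction_sub_le hK y x) (norm_nonneg _) (by positivity)
      _ = 4 * K * ‖y - x‖ := by ring

theorem inner_truncatedSource_apply_le (Q : H →L[ℝ] H) (K : ℝ) (x w : H) :
    ⟪truncatedSource Q K x w, w⟫_ℝ ≤ ‖Q‖ * ‖w‖ ^ 2 := by
  have hrankOne := (InnerProductSpace.isPositive_rankOne_self (𝕜 := ℝ)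
    (ballRetraction K x)).inner_nonneg_left w
  have hQw : ⟪Q w, w⟫_ℝ ≤ ‖Q‖ * ‖w‖ ^ 2 := by
    rw [pow_two, ← mul_assoc]
    exact (real_inner_le_norm _ _).trans (by gcongr; exact Q.le_opNorm w)
  rw [truncatedSource, sub_apply, inner_sub_left]
  linarith

theorem isSymmetric_truncatedSource {Q : H →L[ℝ] H} (hQ : Q.IsSymmetric) (K : ℝ) (x : H) :
    (truncatedSource Q K x).IsSymmetric :=
  hQ.sub (InnerProductSpace.isSymmetric_rankOne_self _)

theorem comp_rankOne_self_comp_eq {P : H →L[ℝ] H} (hP : P.IsSymmetric) (v : H) :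
    P ∘L rankOne ℝ v v ∘L P = rankOne ℝ (P v) (P v) := by
  ext x
  have hv : ⟪v, P x⟫_ℝ = ⟪P v, x⟫_ℝ := (hP v x).symm
  simp only [ContinuousLinearMap.comp_apply, InnerProductSpace.rankOne_apply, map_smul, hv]

theorem truncatedSource_apply_eq (Q : H →L[ℝ] H) {K : ℝ} (hK : 0 < K) {P : H →L[ℝ] H}
    (hP : P.IsSymmetric) {v : H} (hv : ‖P v‖ ≤ K) :
    truncatedSource Q K (P v) = Q - P ∘L rankOne ℝ v v ∘L P := by
  rw [truncatedSource, ballRetraction_eq_self hK hv, comp_rankOne_self_comp_eq hP]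

theorem norm_le_of_isSymmetric_of_inner_le {P : H →L[ℝ] H} {C : ℝ} (hC : 0 ≤ C)
    (hP : P.IsSymmetric) (h : ∀ x, |⟪P x, x⟫_ℝ| ≤ C * ‖x‖ ^ 2) : ‖P‖ ≤ C := by
  rw [ContinuousLinearMap.norm_eq_iSup_rayleighQuotient P hP]
  refine ciSup_le fun x => ?_
  rw [ContinuousLinearMap.rayleighQuotient, abs_div, abs_of_nonneg (sq_nonneg ‖x‖)]
  exact div_le_of_le_mul₀ (sq_nonneg _) hC (h x)

end QuadraticTerm

section Riccati

open ContinuousLinearMap (adjoint)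
open InnerProductSpace (rankOne)

variable {H : Type*} [NormedAddCommGroup H] [InnerProductSpace ℝ H] [CompleteSpace H]
  {S : ℝ → H →L[ℝ] H} {a b : ℝ} {QT : H →L[ℝ] H}

namespace IsMildLyapunov

variable {F F' P P' : ℝ → H →L[ℝ] H}

theorem inner_apply_self_le (hS : IsBicontinuousSemigroup S) (h : IsMildLyapunov S a b QT F P)
    {M C : ℝ} (hM : ∀ t ∈ Icc 0 (b - a), ‖S t‖ ≤ M) (hC : 0 ≤ C)
    (hF : ∀ t ∈ Icc a b, ∀ x, ⟪F t x, x⟫_ℝ ≤ C * ‖x‖ ^ 2) {t : ℝ} (ht : t ∈ Icc a b) (x : H) :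
    ⟪P t x, x⟫_ℝ ≤ (‖QT‖ + (b - a) * C) * M ^ 2 * ‖x‖ ^ 2 := by
  have hSx : ∀ τ ∈ Icc t b, ‖S (τ - t) x‖ ^ 2 ≤ (M * ‖x‖) ^ 2 := fun τ hτ =>
    pow_le_pow_left₀ (norm_nonneg _) ((S (τ - t)).le_of_opNorm_le
      (hM _ ⟨sub_nonneg.2 hτ.1, sub_le_sub hτ.2 ht.1⟩) x) 2
  have hcont : Continuous fun τ => S (τ - t) x := hS.continuous_comp (by fun_prop) continuous_const
  have hterminal : ⟪QT (S (b - t) x), S (b - t) x⟫_ℝ ≤ ‖QT‖ * (M * ‖x‖) ^ 2 :=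
    calc ⟪QT (S (b - t) x), S (b - t) x⟫_ℝ ≤ ‖QT (S (b - t) x)‖ * ‖S (b - t) x‖ :=
          real_inner_le_norm _ _
      _ ≤ ‖QT‖ * ‖S (b - t) x‖ * ‖S (b - t) x‖ := by gcongr; exact QT.le_opNorm _
      _ = ‖QT‖ * ‖S (b - t) x‖ ^ 2 := by ring
      _ ≤ ‖QT‖ * (M * ‖x‖) ^ 2 :=
          mul_le_mul_of_nonneg_left (hSx b (right_mem_Icc.2 ht.2)) (norm_nonneg _)
  have hrunning : ∫ τ in t..b, ⟪F τ (S (τ - t) x), S (τ - t) x⟫_ℝ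
      ≤ ∫ _ in t..b, C * (M * ‖x‖) ^ 2 :=
    intervalIntegral.integral_mono_on ht.2
      (((h.continuous_source_apply_comp hcont).inner hcont).intervalIntegrable _ _)
      intervalIntegrable_const fun τ hτ => (hF τ ⟨ht.1.trans hτ.1, hτ.2⟩ _).trans
        (mul_le_mul_of_nonneg_left (hSx τ hτ) hC)
  rw [h.inner_eq hS ht]
  calc _ ≤ ‖QT‖ * (M * ‖x‖) ^ 2 + (b - t) * (C * (M * ‖x‖) ^ 2) := by
        rw [intervalIntegral.integral_const, smul_eq_mul] at hrunning
        exact add_le_add hterminal hrunning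
    _ ≤ ‖QT‖ * (M * ‖x‖) ^ 2 + (b - a) * (C * (M * ‖x‖) ^ 2) := by
        gcongr
        exact ht.1
    _ = (‖QT‖ + (b - a) * C) * M ^ 2 * ‖x‖ ^ 2 := by ring

/-- Along the closed loop `z' = A z + K z`, the derivative of `⟪P z, z⟫` is
`2 ⟪P z, K z⟫ - ⟪F z, z⟫`. -/
theorem inner_apply_self_nonneg_of_feedback (hS : IsBicontinuousSemigroup S)
    (h : IsMildLyapunov S a b QT F P) (hQT : QT.IsPositive) (hF : ∀ t ∈ Icc a b, (F t).IsSymmetric)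
    {K : ℝ → H →L[ℝ] H} (hK : ∀ x, Continuous fun t => K t x)
    (hle : ∀ t ∈ Icc a b, ∀ x, 2 * ⟪P t x, K t x⟫_ℝ ≤ ⟪F t x, x⟫_ℝ) {t : ℝ} (ht : t ∈ Icc a b)
    (x : H) : 0 ≤ ⟪P t x, x⟫_ℝ := by
  obtain ⟨z, hz⟩ := hS.exists_isMildForward ht.2 x hK (f := 0) continuous_zero
  have hz_left : z t = x := hz.apply_left hS ht.2
  simp only [Pi.zero_apply, add_zero] at hz
  have hsub : Icc t b ⊆ Icc a b := Icc_subset_Icc_left ht.1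
  have hdual := ((h.mono_left ht.1).isMildBackward_apply hS hQT.isSymmetric
    (fun τ hτ => hF τ (hsub hτ)) hz).duality hS ht.2 hz
  have hFz := h.continuous_source_apply_comp hz.continuous
  have hPz := h.continuous_apply_comp hz.continuous
  have hPu := h.continuous_apply_comp hz.continuous_source
  have hcost : 0 ≤ (∫ τ in t..b, ⟪F τ (z τ) - P τ (K τ (z τ)), z τ⟫_ℝ)
      - ∫ τ in t..b, ⟪P τ (z τ), K τ (z τ)⟫_ℝ := by
    rw [← intervalIntegral.integral_sub
      (((hFz.sub hPu).inner hz.continuous).intervalIntegrable _ _)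
      ((hPz.inner hz.continuous_source).intervalIntegrable _ _)]
    refine intervalIntegral.integral_nonneg ht.2 fun τ hτ => ?_
    have hsymm : ⟪P τ (K τ (z τ)), z τ⟫_ℝ = ⟪P τ (z τ), K τ (z τ)⟫_ℝ :=
      (h.isSymmetric hS hQT.isSymmetric hF (hsub hτ) _ _).trans (real_inner_comm _ _)
    rw [inner_sub_left, hsymm]
    linarith [hle τ (hsub hτ) (z τ)]
  rw [hz_left] at hdual
  linarith [hQT.inner_nonneg_left (z b)]

theorem congr_apply (h : IsMildLyapunov S a b QT F P) (h' : IsMildLyapunov S a b QT F' P')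
    (hFF' : EqOn F F' (Icc a b)) : EqOn P P' (Icc a b) := fun t ht => by
  ext x
  rw [(h.congr_source h'.continuous_source hFF').eq x t ht, h'.eq x t ht]

end IsMildLyapunov

/-- `P` is a nonnegative mild solution of the Riccati equation
`P' + P A + A* P - P N P + Q = 0` on `[a, b]` with `P b = QT`, where `A` is the generator of `S`. -/
structure IsRiccatiSolution (S : ℝ → H →L[ℝ] H) (a b : ℝ) (QT Q N : H →L[ℝ] H)
    (P : ℝ → H →L[ℝ] H) : Prop where
  isPositive : ∀ t ∈ Icc a b, (P t).IsPositive
  isMildLyapunov : IsMildLyapunov S a b QT (fun t => Q - P t ∘L N ∘L P t) P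

theorem continuous_sub_comp_comp_apply (Q N : H →L[ℝ] H) {P : ℝ → H →L[ℝ] H}
    (hP : ∀ x, Continuous fun t => P t x) (x : H) :
    Continuous fun t => (Q - P t ∘L N ∘L P t) x := by
  simp only [sub_apply, ContinuousLinearMap.comp_apply]
  exact continuous_const.sub ((continuous_apply_of_forall_continuous hP).comp
    (continuous_id.prodMk (N.continuous.comp (hP x))))

section Truncation

/-- The gain `t ↦ P t v` itself solves a Volterra equation, which determines `P`. -/
theorem exists_isMildLyapunov_of_gain (hS : IsBicontinuousSemigroup S) (hab : a ≤ b)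
    (QT : H →L[ℝ] H) (v : H) {ψ : H → H →L[ℝ] H} {L : NNReal} (hψ : LipschitzWith L ψ) :
    ∃ P, IsMildLyapunov S a b QT (fun t => ψ (P t v)) P := by
  obtain ⟨M, hM0, hM⟩ := hS.exists_norm_le (b - a)
  have hg : Continuous fun t => adjoint (S (b - t)) (QT (S (b - t) v)) :=
    hS.continuous_adjoint_comp (by fun_prop)
      (QT.continuous.comp (hS.continuous_comp (by fun_prop) continuous_const))
  have hk : Continuous fun p : ℝ × ℝ × H =>
      adjoint (S (p.2.1 - p.1)) (ψ p.2.2 (S (p.2.1 - p.1) v)) := by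
    refine hS.continuous_adjoint_comp (by fun_prop) ?_
    exact (hψ.continuous.comp continuous_snd.snd).clm_apply
      (hS.continuous_comp (by fun_prop) continuous_const)
  obtain ⟨f, hf, hf_eq⟩ := exists_volterra_solution_backward hab (L := M * (L * (M * ‖v‖)))
    (by positivity) hg (k := fun t τ y => adjoint (S (τ - t)) (ψ y (S (τ - t) v))) hk
    fun t ht τ hτ x y => by
      have hmem : τ - t ∈ Icc 0 (b - a) := ⟨sub_nonneg.2 hτ.1, sub_le_sub hτ.2 ht.1⟩
      rw [← map_sub, ← sub_apply]
      calc _ ≤ M * (L * ‖x - y‖ * (M * ‖v‖)) :=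
            ContinuousLinearMap.le_of_opNorm_le_of_le _
              ((LinearIsometryEquiv.norm_map _ _).trans_le (hM _ hmem))
              (ContinuousLinearMap.le_of_opNorm_le_of_le _ (hψ.norm_sub_le x y)
                ((S (τ - t)).le_of_opNorm_le (hM _ hmem) v))
        _ = _ := by ring
  obtain ⟨P, hP⟩ := hS.exists_isMildLyapunov a b QT (F := fun t => ψ (f t))
    fun x => (hψ.continuous.comp hf).clm_apply continuous_const
  refine ⟨P, hP.congr_source
    (fun x => (hψ.continuous.comp (hP.continuous v)).clm_apply continuous_const) fun t ht => ?_⟩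
  simp only [hP.eq v t ht, hf_eq t ht]

theorem eqOn_of_isMildLyapunov_of_gain (hS : IsBicontinuousSemigroup S) {v : H}
    {ψ : H → H →L[ℝ] H} {L : NNReal} (hψ : LipschitzWith L ψ)
    {P P' : ℝ → H →L[ℝ] H} (h : IsMildLyapunov S a b QT (fun t => ψ (P t v)) P)
    (h' : IsMildLyapunov S a b QT (fun t => ψ (P' t v)) P') : EqOn P P' (Icc a b) := by
  suffices hgain : EqOn (fun t => P t v - P' t v) 0 (Icc a b) from
    h.congr_apply h' fun t ht => congrArg ψ (sub_eq_zero.1 (hgain ht))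
  obtain ⟨M, -, hM⟩ := hS.exists_norm_le (b - a)
  refine eqOn_zero_of_norm_le_mul_integral_norm_backward (L := M * (L * (M * ‖v‖)))
    ((h.continuous v).sub (h'.continuous v)) fun t ht => ?_
  have hint : ∀ {P}, IsMildLyapunov S a b QT (fun t => ψ (P t v)) P →
      IntervalIntegrable (fun τ => adjoint (S (τ - t)) (ψ (P τ v) (S (τ - t) v))) volume t b :=
    fun h => (hS.continuous_adjoint_comp (by fun_prop) (h.continuous_source_apply_comp
      (hS.continuous_comp (by fun_prop) continuous_const))).intervalIntegrable _ _
  rw [h.eq v t ht, h'.eq v t ht, add_sub_add_left_eq_sub,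
    ← intervalIntegral.integral_sub (hint h) (hint h'), ← intervalIntegral.integral_const_mul]
  refine intervalIntegral.norm_integral_le_of_norm_le ht.2 (.of_forall fun τ hτ => ?_)
    ((((h.continuous v).sub (h'.continuous v)).norm.const_mul _).intervalIntegrable _ _)
  have hmem : τ - t ∈ Icc 0 (b - a) := ⟨sub_nonneg.2 hτ.1.le, sub_le_sub hτ.2 ht.1⟩
  rw [← map_sub, ← sub_apply]
  calc _ ≤ M * (L * ‖P τ v - P' τ v‖ * (M * ‖v‖)) :=
        ContinuousLinearMap.le_of_opNorm_le_of_le _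
          ((LinearIsometryEquiv.norm_map _ _).trans_le (hM _ hmem))
          (ContinuousLinearMap.le_of_opNorm_le_of_le _ (hψ.norm_sub_le _ _)
            ((S (τ - t)).le_of_opNorm_le (hM _ hmem) v))
    _ = _ := by ring

theorem inner_apply_self_nonneg_of_truncated (hS : IsBicontinuousSemigroup S)
    {K : ℝ} (hK : 0 < K) (hQT : QT.IsPositive) {Q : H →L[ℝ] H} (hQ : Q.IsPositive) {v : H}
    {P : ℝ → H →L[ℝ] H} (h : IsMildLyapunov S a b QT (fun t => truncatedSource Q K (P t v)) P)
    {t : ℝ} (ht : t ∈ Icc a b) (x : H) : 0 ≤ ⟪P t x, x⟫_ℝ := by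
  let w := fun t => ballRetraction K (P t v)
  have hw : Continuous w := (continuous_ballRetraction hK).comp (h.continuous v)
  have hF : ∀ t ∈ Icc a b, (truncatedSource Q K (P t v)).IsSymmetric := fun t _ =>
    isSymmetric_truncatedSource hQ.isSymmetric K _
  refine h.inner_apply_self_nonneg_of_feedback hS hQT hF (K := fun t => -rankOne ℝ v (w t))
    (fun x => ?_) (fun t ht x => ?_) ht x
  · simp only [neg_apply, InnerProductSpace.rankOne_apply]
    fun_prop
  · have hsymm : ⟪P t x, v⟫_ℝ = ⟪P t v, x⟫_ℝ :=
      (h.isSymmetric hS hQT.isSymmetric hF ht x v).trans (real_inner_comm _ _)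
    obtain ⟨θ, ⟨hθ0, hθ1⟩, hθ⟩ := exists_ballRetraction_eq_smul hK (P t v)
    simp only [w, truncatedSource, hθ, sub_apply, neg_apply, InnerProductSpace.rankOne_apply,
      inner_sub_left, inner_neg_right, inner_smul_left, inner_smul_right, hsymm, conj_trivial]
    nlinarith [hQ.inner_nonneg_left x, mul_nonneg (mul_nonneg hθ0 (sub_nonneg.2 hθ1))
      (sq_nonneg ⟪P t v, x⟫_ℝ), mul_nonneg hθ0 (sq_nonneg ⟪P t v, x⟫_ℝ)]

end Truncation

namespace IsBicontinuousSemigroup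

/-- The gain `P v` solves a closed equation with a quadratic nonlinearity. Truncating it makes the
equation globally solvable and keeps `P` nonnegative; then `P` is bounded above by the solution
with no quadratic term, so a large truncation is never active. -/
theorem exists_isRiccatiSolution (hS : IsBicontinuousSemigroup S) (hab : a ≤ b)
    (hQT : QT.IsPositive) {Q : H →L[ℝ] H} (hQ : Q.IsPositive) (v : H) :
    ∃ P, IsRiccatiSolution S a b QT Q (rankOne ℝ v v) P := by
  obtain ⟨M, -, hM⟩ := hS.exists_norm_le (b - a)
  set C := (‖QT‖ + (b - a) * ‖Q‖) * M ^ 2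
  have hC : 0 ≤ C :=
    mul_nonneg (add_nonneg (norm_nonneg _) (mul_nonneg (sub_nonneg.2 hab) (norm_nonneg _)))
      (sq_nonneg M)
  set K := C * ‖v‖ + 1
  have hK : 0 < K := by positivity
  obtain ⟨P, hP⟩ := exists_isMildLyapunov_of_gain hS hab QT v (lipschitzWith_truncatedSource Q hK)
  have hnonneg : ∀ t ∈ Icc a b, ∀ x, 0 ≤ ⟪P t x, x⟫_ℝ := fun t =>
    inner_apply_self_nonneg_of_truncated hS hK hQT hQ hP
  have hsymm : ∀ t ∈ Icc a b, (P t).IsSymmetric := fun t =>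
    hP.isSymmetric hS hQT.isSymmetric fun t _ => isSymmetric_truncatedSource hQ.isSymmetric K _
  have hle : ∀ t ∈ Icc a b, ∀ x, |⟪P t x, x⟫_ℝ| ≤ C * ‖x‖ ^ 2 := fun t ht x => by
    rw [abs_of_nonneg (hnonneg t ht x)]
    exact hP.inner_apply_self_le hS hM (norm_nonneg Q)
      (fun t _ => inner_truncatedSource_apply_le Q K (P t v)) ht x
  have hnorm : ∀ t ∈ Icc a b, ‖P t v‖ ≤ K := fun t ht =>
    ((P t).le_of_opNorm_le (norm_le_of_isSymmetric_of_inner_le hC (hsymm t ht) (hle t ht)) v).trans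
      (le_add_of_nonneg_right zero_le_one)
  exact ⟨P, fun t ht => (ContinuousLinearMap.isPositive_iff _).2 ⟨hsymm t ht, hnonneg t ht⟩,
    hP.congr_source (continuous_sub_comp_comp_apply Q _ hP.continuous) fun t ht =>
      truncatedSource_apply_eq Q hK (hsymm t ht) (hnorm t ht)⟩

end IsBicontinuousSemigroup

namespace IsRiccatiSolution

theorem eqOn (hS : IsBicontinuousSemigroup S) {Q : H →L[ℝ] H} {v : H} {P P' : ℝ → H →L[ℝ] H}
    (h : IsRiccatiSolution S a b QT Q (rankOne ℝ v v) P)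
    (h' : IsRiccatiSolution S a b QT Q (rankOne ℝ v v) P') : EqOn P P' (Icc a b) := by
  obtain ⟨C, hC0, hC⟩ := exists_norm_le_of_forall_continuousOn (isCompact_Icc (a := a) (b := b))
    fun x => (h.isMildLyapunov.continuous x).continuousOn
  obtain ⟨C', hC'0, hC'⟩ := exists_norm_le_of_forall_continuousOn (isCompact_Icc (a := a) (b := b))
    fun x => (h'.isMildLyapunov.continuous x).continuousOn
  set K := (C + C') * ‖v‖ + 1
  have hK : 0 < K := by positivity
  have htruncated : ∀ {P}, IsRiccatiSolution S a b QT Q (rankOne ℝ v v) P →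
      (∀ t ∈ Icc a b, ‖P t‖ ≤ C + C') →
      IsMildLyapunov S a b QT (fun t => truncatedSource Q K (P t v)) P :=
    fun {P} h hP => h.isMildLyapunov.congr_source
      (fun x => ((lipschitzWith_truncatedSource Q hK).continuous.comp
        (h.isMildLyapunov.continuous v)).clm_apply continuous_const)
      fun t ht => (truncatedSource_apply_eq Q hK (h.isPositive t ht).isSymmetric
        (((P t).le_of_opNorm_le (hP t ht) v).trans (le_add_of_nonneg_right zero_le_one))).symm
  exact eqOn_of_isMildLyapunov_of_gain hS (lipschitzWith_truncatedSource Q hK)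
    (htruncated h fun t ht => (hC t ht).trans (le_add_of_nonneg_right hC'0))
    (htruncated h' fun t ht => (hC' t ht).trans (le_add_of_nonneg_left hC0))

end IsRiccatiSolution

end Riccati

section HamiltonianSystem

open ContinuousLinearMap (adjoint)
open InnerProductSpace (rankOne)

variable {H : Type*} [NormedAddCommGroup H] [InnerProductSpace ℝ H] [CompleteSpace H]
  {S : ℝ → H →L[ℝ] H} {a b : ℝ} {x y m : H} {v : H}

/-- `(z, p)` is a mild solution on `[a, b]` of the Hamiltonian system
`z' = A z - N p`, `z a = x`, `p' + A* p + M z + m = 0`, `p b = MT (z b) + y`, where `A` is the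
generator of `S`. -/
structure IsHamiltonianSolution (S : ℝ → H →L[ℝ] H) (a b : ℝ) (MT M N : H →L[ℝ] H) (x y m : H)
    (z p : ℝ → H) : Prop where
  forward : IsMildForward S a b x (fun t => -N (p t)) z
  backward : IsMildBackward S a b (MT (z b) + y) (fun t => M (z t) + m) p

/-- `(z, r)` is a mild solution on `[a, b]` of the system
`z' = A z - N (P z + r)`, `z a = x`, `r' + A* r - P N r + L z + m = 0`, `r b = LT (z b) + y`,
where `A` is the generator of `S`. -/
structure IsClosedLoopSolution (S : ℝ → H →L[ℝ] H) (a b : ℝ) (P : ℝ → H →L[ℝ] H)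
    (LT L N : H →L[ℝ] H) (x y m : H) (z r : ℝ → H) : Prop where
  forward : IsMildForward S a b x (fun t => -N (P t (z t) + r t)) z
  backward : IsMildBackward S a b (LT (z b) + y) (fun t => L (z t) + m - P t (N (r t))) r

namespace IsRiccatiSolution

variable {QT Q N : H →L[ℝ] H} {P : ℝ → H →L[ℝ] H}

theorem isMildBackward_apply (hP : IsRiccatiSolution S a b QT Q N P)
    (hS : IsBicontinuousSemigroup S) (hQT : QT.IsSymmetric) (hQ : Q.IsSymmetric)
    (hN : N.IsSymmetric) {r z : ℝ → H}
    (hz : IsMildForward S a b x (fun t => -N (P t (z t) + r t)) z) :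
    IsMildBackward S a b (QT (z b)) (fun t => Q (z t) + P t (N (r t))) fun t => P t (z t) := by
  have hF : ∀ t ∈ Icc a b, (Q - P t ∘L N ∘L P t).IsSymmetric := fun t ht => by
    have hPt := (hP.isPositive t ht).isSymmetric
    refine hQ.sub fun w w' => ?_
    exact (hPt _ _).trans ((hN _ _).trans (hPt _ _))
  convert hP.isMildLyapunov.isMildBackward_apply hS hQT hF hz using 2 with t
  simp only [sub_apply, ContinuousLinearMap.comp_apply, map_add, map_neg]
  abel

variable {LT L : H →L[ℝ] H}

/-- The ansatz `p = P z + r` decouples the Hamiltonian system. -/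
theorem isHamiltonianSolution_of_isClosedLoopSolution (hP : IsRiccatiSolution S a b QT Q N P)
    (hS : IsBicontinuousSemigroup S) (hQT : QT.IsSymmetric) (hQ : Q.IsSymmetric)
    (hN : N.IsSymmetric) {z r : ℝ → H} (h : IsClosedLoopSolution S a b P LT L N x y m z r) :
    IsHamiltonianSolution S a b (QT + LT) (Q + L) N x y m z fun t => P t (z t) + r t where
  forward := h.forward
  backward := by
    convert (hP.isMildBackward_apply hS hQT hQ hN h.forward).add hS h.backward using 1
    · rw [add_apply, add_assoc]
    · ext t
      simp only [add_apply, Pi.add_apply]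
      abel
    · rfl

theorem isClosedLoopSolution_of_isHamiltonianSolution (hP : IsRiccatiSolution S a b QT Q N P)
    (hS : IsBicontinuousSemigroup S) (hQT : QT.IsSymmetric) (hQ : Q.IsSymmetric)
    (hN : N.IsSymmetric) {z p : ℝ → H}
    (h : IsHamiltonianSolution S a b (QT + LT) (Q + L) N x y m z p) :
    IsClosedLoopSolution S a b P LT L N x y m z fun t => p t - P t (z t) := by
  have hforward : IsMildForward S a b x (fun t => -N (P t (z t) + (p t - P t (z t)))) z := by
    simpa only [add_sub_cancel] using h.forward
  refine ⟨hforward, ?_⟩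
  convert h.backward.sub hS (hP.isMildBackward_apply hS hQT hQ hN hforward) using 1
  · rw [add_apply]
    abel
  · ext t
    simp only [add_apply, Pi.sub_apply]
    abel
  · rfl

end IsRiccatiSolution

variable {MT M : H →L[ℝ] H}

/-- Decouple with the solution of the Riccati equation for `(MT, M)`, which leaves a linear
backward equation independent of `z`. -/
theorem exists_isHamiltonianSolution (hS : IsBicontinuousSemigroup S) (hab : a ≤ b)
    (hMT : MT.IsPositive) (hM : M.IsPositive) (v x y m : H) :
    ∃ z p, IsHamiltonianSolution S a b MT M (rankOne ℝ v v) x y m z p := by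
  obtain ⟨X, hX⟩ := hS.exists_isRiccatiSolution hab hMT hM v
  have hXc := hX.isMildLyapunov.continuous
  obtain ⟨r, hr⟩ := hS.exists_isMildBackward hab y (K := fun t => -(X t ∘L rankOne ℝ v v))
    (fun x => (hXc (rankOne ℝ v v x)).neg) (f := fun _ => m) continuous_const
  obtain ⟨z, hz⟩ := hS.exists_isMildForward hab x (K := fun t => -(rankOne ℝ v v ∘L X t))
    (fun x => ((rankOne ℝ v v).continuous.comp (hXc x)).neg) (f := fun t => -rankOne ℝ v v (r t))
    ((rankOne ℝ v v).continuous.comp hr.continuous).neg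
  have hclosed : IsClosedLoopSolution S a b X 0 0 (rankOne ℝ v v) x y m z r := by
    refine ⟨?_, ?_⟩
    · convert hz using 2 with t
      simp only [neg_apply, ContinuousLinearMap.comp_apply, map_add, neg_add]
    · convert hr using 1
      · rw [zero_apply, zero_add]
      · ext t
        simp only [zero_apply, zero_add, neg_apply, ContinuousLinearMap.comp_apply,
          sub_eq_neg_add]
  have hham := hX.isHamiltonianSolution_of_isClosedLoopSolution hS hMT.isSymmetric hM.isSymmetric
    (InnerProductSpace.isSymmetric_rankOne_self v) hclosed
  simp only [add_zero] at hham
  exact ⟨z, _, hham⟩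

namespace IsHamiltonianSolution

variable {z z' p p' : ℝ → H}

/-- Duality gives `∫ ⟪v, p - p'⟫² = -⟪MT δ, δ⟫ - ∫ ⟪M (z - z'), z - z'⟫`, with `δ = z b - z' b`. -/
theorem inner_costate_eq (hS : IsBicontinuousSemigroup S) (hab : a < b) (hMT : MT.IsPositive)
    (hM : M.IsPositive) (h : IsHamiltonianSolution S a b MT M (rankOne ℝ v v) x y m z p)
    (h' : IsHamiltonianSolution S a b MT M (rankOne ℝ v v) x y m z' p') :
    ∀ t ∈ Icc a b, ⟪v, p t⟫_ℝ = ⟪v, p' t⟫_ℝ := by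
  have hdual := (h.backward.sub hS h'.backward).duality hS hab.le (h.forward.sub hS h'.forward)
  have hterminal : 0 ≤ ⟪MT (z b) + y - (MT (z' b) + y), (z - z') b⟫_ℝ := by
    rw [add_sub_add_right_eq_sub, ← map_sub]
    exact hMT.inner_nonneg_left _
  have hrunning : 0 ≤ ∫ t in a..b,
      ⟪((fun t => M (z t) + m) - fun t => M (z' t) + m) t, (z - z') t⟫_ℝ :=
    intervalIntegral.integral_nonneg hab.le fun t _ => by
      simp only [Pi.sub_apply, add_sub_add_right_eq_sub, ← map_sub]
      exact hM.inner_nonneg_left _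
  have hcost : ∫ t in a..b, ⟪(p - p') t,
      ((fun t => -rankOne ℝ v v (p t)) - fun t => -rankOne ℝ v v (p' t)) t⟫_ℝ
      = -∫ t in a..b, ⟪v, p t - p' t⟫_ℝ ^ 2 := by
    rw [← intervalIntegral.integral_neg]
    congr 1 with t
    simp only [Pi.sub_apply, InnerProductSpace.rankOne_apply, ← neg_smul, ← sub_smul,
      inner_smul_right, inner_sub_right, real_inner_comm v]
    ring
  rw [sub_self, inner_zero_right, zero_add, hcost] at hdual
  by_contra! hne
  obtain ⟨t, ht, hne⟩ := hne
  have hpos : 0 < ∫ t in a..b, ⟪v, p t - p' t⟫_ℝ ^ 2 :=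
    intervalIntegral.integral_pos hab ((continuous_const.inner
      (h.backward.continuous.sub h'.backward.continuous)).pow 2).continuousOn
      (fun _ _ => sq_nonneg _)
      ⟨t, ht, by rw [inner_sub_right]; exact sq_pos_of_ne_zero (sub_ne_zero.2 hne)⟩
  linarith

theorem eqOn (hS : IsBicontinuousSemigroup S) (hab : a < b) (hMT : MT.IsPositive)
    (hM : M.IsPositive) (h : IsHamiltonianSolution S a b MT M (rankOne ℝ v v) x y m z p)
    (h' : IsHamiltonianSolution S a b MT M (rankOne ℝ v v) x y m z' p') :
    EqOn z z' (Icc a b) ∧ EqOn p p' (Icc a b) := by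
  have hv := h.inner_costate_eq hS hab hMT hM h'
  have hz : EqOn z z' (Icc a b) := fun t ht => by
    rw [h.forward.eq t ht, h'.forward.eq t ht]
    refine congrArg _ (intervalIntegral.integral_congr fun τ hτ => ?_)
    rw [uIcc_of_le ht.1] at hτ
    simp only [InnerProductSpace.rankOne_apply, hv τ ⟨hτ.1, hτ.2.trans ht.2⟩]
  refine ⟨hz, fun t ht => ?_⟩
  rw [h.backward.eq t ht, h'.backward.eq t ht, hz (right_mem_Icc.2 hab.le)]
  refine congrArg _ (intervalIntegral.integral_congr fun τ hτ => ?_)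
  rw [uIcc_of_le ht.2] at hτ
  simp only [hz ⟨ht.1.trans hτ.1, hτ.2⟩]

end IsHamiltonianSolution

end HamiltonianSystem

section LQMSolution

open ContinuousLinearMap (adjoint)
open InnerProductSpace (rankOne)

theorem eqOn_comp_projIcc {X : Type*} (f : ℝ → X) {a b : ℝ} (hab : a ≤ b) :
    EqOn (fun t => f (projIcc a b hab t)) f (Icc a b) := fun t ht => by
  simp only [projIcc_of_mem hab ht]

theorem continuous_comp_projIcc {X : Type*} [TopologicalSpace X] {f : ℝ → X} {a b : ℝ}
    (hab : a ≤ b) (hf : ContinuousOn f (Icc a b)) : Continuous fun t => f (projIcc a b hab t) :=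
  hf.comp_continuous (by fun_prop) fun t => (projIcc a b hab t).2

theorem intervalIntegral_comp_max_sub_left {X : Type*} [NormedAddCommGroup X] [NormedSpace ℝ X]
    (F : ℝ → ℝ → X) {t T : ℝ} (ht : t ≤ T) :
    ∫ τ in t..T, F (max (τ - t) 0) τ = ∫ τ in t..T, F (τ - t) τ :=
  intervalIntegral.integral_congr fun τ hτ => by
    rw [uIcc_of_le ht] at hτ
    simp only [max_eq_left (sub_nonneg.2 hτ.1)]

theorem intervalIntegral_comp_max_sub_right {X : Type*} [NormedAddCommGroup X] [NormedSpace ℝ X]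
    (F : ℝ → ℝ → X) {a t : ℝ} (ht : a ≤ t) :
    ∫ τ in a..t, F (max (t - τ) 0) τ = ∫ τ in a..t, F (t - τ) τ :=
  intervalIntegral.integral_congr fun τ hτ => by
    rw [uIcc_of_le ht] at hτ
    simp only [max_eq_left (sub_nonneg.2 hτ.2)]

variable {H : Type*} [NormedAddCommGroup H] [InnerProductSpace ℝ H] [CompleteSpace H]

theorem opTrace_rankOne (x y : H) : opTrace (rankOne ℝ x y) = ⟪y, x⟫_ℝ := by
  obtain ⟨e, he⟩ := (exists_hilbertBasis ℝ H).choose_spec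
  rw [opTrace, ← e.tsum_inner_mul_inner y x]
  refine tsum_congr fun i => ?_
  rw [InnerProductSpace.rankOne_apply, inner_smul_right, he]

theorem opTrace_rankOne_comp (x y : H) (P : H →L[ℝ] H) :
    opTrace (rankOne ℝ x y ∘L P) = ⟪y, P x⟫_ℝ := by
  rw [InnerProductSpace.rankOne_comp, opTrace_rankOne, ContinuousLinearMap.adjoint_inner_left]

variable {U K : Type*} [NormedAddCommGroup U] [InnerProductSpace ℝ U] [CompleteSpace U]
  [NormedAddCommGroup K] [InnerProductSpace ℝ K]
  {D : LQMData H U K} {E : ℝ → H →L[ℝ] H} {T : ℝ} {z₀ : H} {P P' : ℝ → H →L[ℝ] H}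
  {r r' z z' : ℝ → H}

namespace IsC0Semigroup

variable {f g : ℝ → H} {a b t : ℝ}

theorem sub_integral_sub_integral (hE : IsC0Semigroup E) (hf : Continuous f) (hg : Continuous g)
    (ht : a ≤ t) (x : H) :
    x - (∫ τ in a..t, E (t - τ) (f τ)) - (∫ τ in a..t, E (t - τ) (g τ))
      = x + ∫ τ in a..t, E (max (t - τ) 0) (-(f τ + g τ)) := by
  have hint : ∀ {f : ℝ → H}, Continuous f →
      IntervalIntegrable (fun τ => E (max (t - τ) 0) (f τ)) volume a t := fun hf =>
    (hE.isBicontinuousSemigroup.continuous_comp (f := fun τ => t - τ) (by fun_prop)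
      hf).intervalIntegrable _ _
  rw [← intervalIntegral_comp_max_sub_right (fun h τ => E h (f τ)) ht,
    ← intervalIntegral_comp_max_sub_right (fun h τ => E h (g τ)) ht, sub_sub,
    ← intervalIntegral.integral_add (hint hf) (hint hg), sub_eq_add_neg,
    ← intervalIntegral.integral_neg]
  simp only [_root_.map_neg, _root_.map_add]

theorem sub_integral_adjoint_sub_integral_adjoint (hE : IsC0Semigroup E) (hf : Continuous f)
    (hg : Continuous g) (ht : t ≤ b) (x : H) :
    x - (∫ τ in t..b, adjoint (E (τ - t)) (f τ)) - (∫ τ in t..b, adjoint (E (τ - t)) (g τ))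
      = x + ∫ τ in t..b, adjoint (E (max (τ - t) 0)) (-(f τ + g τ)) := by
  have hint : ∀ {f : ℝ → H}, Continuous f →
      IntervalIntegrable (fun τ => adjoint (E (max (τ - t) 0)) (f τ)) volume t b := fun hf =>
    (hE.isBicontinuousSemigroup.continuous_adjoint_comp (f := fun τ => τ - t) (by fun_prop)
      hf).intervalIntegrable _ _
  rw [← intervalIntegral_comp_max_sub_left (fun h τ => adjoint (E h) (f τ)) ht,
    ← intervalIntegral_comp_max_sub_left (fun h τ => adjoint (E h) (g τ)) ht, sub_sub,
    ← intervalIntegral.integral_add (hint hf) (hint hg), sub_eq_add_neg,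
    ← intervalIntegral.integral_neg]
  simp only [_root_.map_neg, _root_.map_add]

end IsC0Semigroup

namespace LQMData

theorem IsMildRiccati.congr (h : D.IsMildRiccati E T P) (hP : EqOn P' P (Icc 0 T)) :
    D.IsMildRiccati E T P' where
  isPositive t ht := by
    rw [hP ht]
    exact h.isPositive t ht
  continuousOn x := (h.continuousOn x).congr fun t ht => by simp only [hP ht]
  eq x t ht := by
    rw [hP ht, h.eq x t ht]
    congr 1
    refine intervalIntegral.integral_congr fun τ hτ => ?_
    rw [uIcc_of_le ht.2] at hτ
    simp only [hP ⟨ht.1.trans hτ.1, hτ.2⟩]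

theorem IsMildForwardBackward.congr (h : D.IsMildForwardBackward E T z₀ P z r)
    (hP : EqOn P' P (Icc 0 T)) (hz : EqOn z' z (Icc 0 T)) (hr : EqOn r' r (Icc 0 T)) :
    D.IsMildForwardBackward E T z₀ P' z' r' where
  continuousOn_z := h.continuousOn_z.congr hz
  continuousOn_r := h.continuousOn_r.congr hr
  eq_z t ht := by
    have hmem : ∀ τ ∈ uIcc 0 t, τ ∈ Icc 0 T := fun τ hτ => by
      rw [uIcc_of_le ht.1] at hτ
      exact ⟨hτ.1, hτ.2.trans ht.2⟩
    rw [hz ht, h.eq_z t ht]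
    congr 1
    · refine congrArg _ (intervalIntegral.integral_congr fun τ hτ => ?_)
      simp only [hP (hmem τ hτ), hz (hmem τ hτ)]
    · refine intervalIntegral.integral_congr fun τ hτ => ?_
      simp only [hr (hmem τ hτ)]
  eq_r t ht := by
    have hmem : ∀ τ ∈ uIcc t T, τ ∈ Icc 0 T := fun τ hτ => by
      rw [uIcc_of_le ht.2] at hτ
      exact ⟨ht.1.trans hτ.1, hτ.2⟩
    rw [hr ht, h.eq_r t ht, hz (right_mem_Icc.2 (ht.1.trans ht.2))]
    congr 1
    · refine congrArg _ (intervalIntegral.integral_congr fun τ hτ => ?_)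
      simp only [hP (hmem τ hτ), hr (hmem τ hτ)]
    · refine intervalIntegral.integral_congr fun τ hτ => ?_
      simp only [hz (hmem τ hτ)]

theorem isMildRiccati_iff (hE : IsC0Semigroup E) (hP : ∀ x, Continuous fun t => P t x) :
    D.IsMildRiccati E T P ↔ IsRiccatiSolution (fun t => E (max t 0)) 0 T (D.QT + D.QbarT)
      (D.Q + D.Qbar) D.BRB P := by
  have hS := hE.isBicontinuousSemigroup
  have hP' := continuous_apply_of_forall_continuous hP
  have hrhs : ∀ x, ∀ t ∈ Icc 0 T,
      adjoint (E (T - t)) ((D.QT + D.QbarT) (E (T - t) x))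
        + (∫ τ in t..T, adjoint (E (τ - t)) ((D.Q + D.Qbar) (E (τ - t) x)))
        - (∫ τ in t..T, adjoint (E (τ - t)) (P τ (D.BRB (P τ (E (τ - t) x)))))
      = adjoint (E (max (T - t) 0)) ((D.QT + D.QbarT) (E (max (T - t) 0) x))
        + ∫ τ in t..T, adjoint (E (max (τ - t) 0))
            ((D.Q + D.Qbar - P τ ∘L D.BRB ∘L P τ) (E (max (τ - t) 0) x)) := fun x t ht => by
    have hSx : Continuous fun τ => E (max (τ - t) 0) x :=
      hS.continuous_comp (f := fun τ => τ - t) (by fun_prop) continuous_const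
    have hlin : Continuous fun τ =>
        adjoint (E (max (τ - t) 0)) ((D.Q + D.Qbar) (E (max (τ - t) 0) x)) :=
      hS.continuous_adjoint_comp (f := fun τ => τ - t) (by fun_prop)
        ((D.Q + D.Qbar).continuous.comp hSx)
    have hquad : Continuous fun τ =>
        adjoint (E (max (τ - t) 0)) (P τ (D.BRB (P τ (E (max (τ - t) 0) x)))) := by
      refine hS.continuous_adjoint_comp (f := fun τ => τ - t) (by fun_prop) ?_
      exact hP'.comp (continuous_id.prodMk (D.BRB.continuous.comp
        (hP'.comp (continuous_id.prodMk hSx))))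
    rw [← intervalIntegral_comp_max_sub_left
        (fun h _ => adjoint (E h) ((D.Q + D.Qbar) (E h x))) ht.2,
      ← intervalIntegral_comp_max_sub_left
        (fun h τ => adjoint (E h) (P τ (D.BRB (P τ (E h x))))) ht.2,
      add_sub_assoc, ← intervalIntegral.integral_sub (hlin.intervalIntegrable _ _)
        (hquad.intervalIntegrable _ _), max_eq_left (sub_nonneg.2 ht.2)]
    simp only [sub_apply, ContinuousLinearMap.comp_apply, map_sub]
  refine ⟨fun h => ⟨h.isPositive, continuous_sub_comp_comp_apply _ _ hP, hP,
    fun x t ht => (h.eq x t ht).trans (hrhs x t ht)⟩, fun h => ⟨h.isPositive,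
    fun x => (hP x).continuousOn, fun x t ht =>
      (h.isMildLyapunov.eq x t ht).trans (hrhs x t ht).symm⟩⟩

theorem isMildForwardBackward_iff (hE : IsC0Semigroup E) (hP : ∀ x, Continuous fun t => P t x)
    (hz : Continuous z) (hr : Continuous r) :
    D.IsMildForwardBackward E T z₀ P z r ↔ IsClosedLoopSolution (fun t => E (max t 0)) 0 T P
      (-(D.QbarT ∘L D.ST)) (-(D.Qbar ∘L D.S)) D.BRB z₀ D.ℓT D.ℓ z r := by
  have hPc := continuous_apply_of_forall_continuous hP
  have hPz : Continuous fun τ => D.BRB (P τ (z τ)) :=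
    D.BRB.continuous.comp (hPc.comp (continuous_id.prodMk hz))
  have hr' : Continuous fun τ => D.BRB (r τ) := D.BRB.continuous.comp hr
  have hPr : Continuous fun τ => P τ (D.BRB (r τ)) := hPc.comp (continuous_id.prodMk hr')
  have hSz : Continuous fun τ => D.Qbar (D.S (z τ)) - D.ℓ := by fun_prop
  have hforward : ∀ τ, -D.BRB (P τ (z τ) + r τ) = -(D.BRB (P τ (z τ)) + D.BRB (r τ)) :=
    fun τ => by rw [map_add]
  have hbackward : ∀ τ, (-(D.Qbar ∘L D.S)) (z τ) + D.ℓ - P τ (D.BRB (r τ))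
      = -(P τ (D.BRB (r τ)) + (D.Qbar (D.S (z τ)) - D.ℓ)) := fun τ => by
    rw [neg_apply, ContinuousLinearMap.comp_apply]
    abel
  constructor
  · refine fun h => ⟨⟨?_, hz, fun t ht => ?_⟩, ?_, hr, fun t ht => ?_⟩
    · simp only [hforward]
      exact (hPz.add hr').neg
    · simp only [hforward]
      rw [← hE.sub_integral_sub_integral hPz hr' ht.1, sub_zero, max_eq_left ht.1, h.eq_z t ht]
    · simp only [hbackward]
      exact (hPr.add hSz).neg
    · simp only [hbackward]
      rw [← hE.sub_integral_adjoint_sub_integral_adjoint hPr hSz ht.2,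
        max_eq_left (sub_nonneg.2 ht.2), h.eq_r t ht]
      rfl
  · refine fun h => ⟨hz.continuousOn, hr.continuousOn, fun t ht => ?_, fun t ht => ?_⟩
    · rw [hE.sub_integral_sub_integral hPz hr' ht.1, h.forward.eq t ht, sub_zero,
        max_eq_left ht.1]
      simp only [hforward]
    · rw [hE.sub_integral_adjoint_sub_integral_adjoint hPr hSz ht.2, h.backward.eq t ht,
        max_eq_left (sub_nonneg.2 ht.2)]
      simp only [hbackward]
      rfl

variable [CompleteSpace K]

/-- A game with scalar control and scalar noise, whose cost operators are nonnegative both with and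
without the coupling to the mean of the population. The last two conditions play the role of the
Lasry-Lions monotonicity: they make the coupled forward-backward system uniquely solvable. -/
structure IsMonotoneScalar (D : LQMData H U K) (v g : H) : Prop where
  BRB_eq : D.BRB = rankOne ℝ v v
  noise_eq : D.σ ∘L adjoint D.σ = rankOne ℝ g g
  continuous_c : Continuous D.c
  isPositive_terminal : (D.QT + D.QbarT).IsPositive
  isPositive_running : (D.Q + D.Qbar).IsPositive
  isPositive_terminal_coupled : (D.QT + D.QbarT + -(D.QbarT ∘L D.ST)).IsPositive
  isPositive_running_coupled : (D.Q + D.Qbar + -(D.Qbar ∘L D.S)).IsPositive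

namespace IsMonotoneScalar

variable {v g : H}

theorem continuous_cost (hD : D.IsMonotoneScalar v g) (hP : ∀ x, Continuous fun t => P t x)
    (hz : Continuous z) (hr : Continuous r) :
    Continuous fun τ => 1 / 2 * opTrace (D.σ ∘L adjoint D.σ ∘L P τ)
      - 1 / 2 * ⟪D.BRB (r τ), r τ⟫_ℝ + 1 / 2 * ⟪D.Qbar (D.S (z τ)), D.S (z τ)⟫_ℝ + D.c (z τ) := by
  have hcz : Continuous fun τ => D.c (z τ) := hD.continuous_c.comp hz
  have hPg := hP g
  simp only [← ContinuousLinearMap.comp_assoc, hD.noise_eq, opTrace_rankOne_comp]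
  fun_prop

theorem exists_isLQMMildSolution (hD : D.IsMonotoneScalar v g) (hE : IsC0Semigroup E)
    (hT : 0 ≤ T) (z₀ : H) : ∃ P r z s, D.IsLQMMildSolution E T z₀ P r z s := by
  have hS := hE.isBicontinuousSemigroup
  obtain ⟨P, hP⟩ := hS.exists_isRiccatiSolution hT hD.isPositive_terminal hD.isPositive_running v
  obtain ⟨z, p, hzp⟩ := exists_isHamiltonianSolution hS hT hD.isPositive_terminal_coupled
    hD.isPositive_running_coupled v z₀ D.ℓT D.ℓ
  have hclosed := hP.isClosedLoopSolution_of_isHamiltonianSolution hS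
    hD.isPositive_terminal.isSymmetric hD.isPositive_running.isSymmetric
    (InnerProductSpace.isSymmetric_rankOne_self v) hzp
  rw [← hD.BRB_eq] at hP hclosed
  have hPc := hP.isMildLyapunov.continuous
  have hz := hclosed.forward.continuous
  have hr := hclosed.backward.continuous
  have hprimitive : ∀ {f : ℝ → ℝ}, Continuous f → Continuous fun t => ∫ τ in t..T, f τ :=
    fun {f} hf => continuous_intervalIntegral_left (f := fun _ => f) (hf.comp continuous_snd) T
  exact ⟨P, _, z, _, (isMildRiccati_iff hE hPc).2 hP,
    (isMildForwardBackward_iff hE hPc hz hr).2 hclosed,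
    (continuous_const.add (hprimitive (hD.continuous_cost hPc hz hr))).continuousOn, fun t _ => rfl⟩

theorem eqOn_of_isMildRiccati (hD : D.IsMonotoneScalar v g) (hE : IsC0Semigroup E) (hT : 0 ≤ T)
    (h : D.IsMildRiccati E T P) (h' : D.IsMildRiccati E T P') : EqOn P P' (Icc 0 T) := by
  have hriccati : ∀ {P}, D.IsMildRiccati E T P → IsRiccatiSolution (fun t => E (max t 0)) 0 T
      (D.QT + D.QbarT) (D.Q + D.Qbar) (rankOne ℝ v v) fun t => P (projIcc 0 T hT t) :=
    fun {P} h => hD.BRB_eq ▸ (isMildRiccati_iff hE fun x =>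
      continuous_comp_projIcc hT (h.continuousOn x)).1 (h.congr (eqOn_comp_projIcc P hT))
  exact (eqOn_comp_projIcc P hT).symm.trans
    ((IsRiccatiSolution.eqOn hE.isBicontinuousSemigroup (hriccati h) (hriccati h')).trans
      (eqOn_comp_projIcc P' hT))

theorem eqOn_of_isMildForwardBackward (hD : D.IsMonotoneScalar v g) (hE : IsC0Semigroup E)
    (hT : 0 < T) (hP : D.IsMildRiccati E T P) (h : D.IsMildForwardBackward E T z₀ P z r)
    (h' : D.IsMildForwardBackward E T z₀ P z' r') :
    EqOn z z' (Icc 0 T) ∧ EqOn r r' (Icc 0 T) := by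
  have hS := hE.isBicontinuousSemigroup
  set proj : ℝ → ℝ := fun t => projIcc 0 T hT.le t
  have hproj : ∀ {X : Type _} (f : ℝ → X), EqOn (fun t => f (proj t)) f (Icc 0 T) :=
    fun f => eqOn_comp_projIcc f hT.le
  have hPc : ∀ x, Continuous fun t => P (proj t) x := fun x =>
    continuous_comp_projIcc hT.le (hP.continuousOn x)
  have hriccati := (isMildRiccati_iff hE hPc).1 (hP.congr (hproj P))
  have hhamiltonian : ∀ {z r}, D.IsMildForwardBackward E T z₀ P z r →
      IsHamiltonianSolution (fun t => E (max t 0)) 0 T (D.QT + D.QbarT + -(D.QbarT ∘L D.ST))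
        (D.Q + D.Qbar + -(D.Qbar ∘L D.S)) (rankOne ℝ v v) z₀ D.ℓT D.ℓ (fun t => z (proj t))
        fun t => P (proj t) (z (proj t)) + r (proj t) := fun {z r} h =>
    hD.BRB_eq ▸ hriccati.isHamiltonianSolution_of_isClosedLoopSolution hS
      hD.isPositive_terminal.isSymmetric hD.isPositive_running.isSymmetric
      (hD.BRB_eq ▸ InnerProductSpace.isSymmetric_rankOne_self v)
      ((isMildForwardBackward_iff hE hPc (continuous_comp_projIcc hT.le h.continuousOn_z)
        (continuous_comp_projIcc hT.le h.continuousOn_r)).1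
        (h.congr (hproj P) (hproj z) (hproj r)))
  obtain ⟨hz, hp⟩ := (hhamiltonian h).eqOn hS hT hD.isPositive_terminal_coupled
    hD.isPositive_running_coupled (hhamiltonian h')
  have hzz' : EqOn z z' (Icc 0 T) := ((hproj z).symm.trans hz).trans (hproj z')
  refine ⟨hzz', fun t ht => ?_⟩
  have hpt := hp ht
  simp only [hproj _ ht, hzz' ht, add_right_inj] at hpt
  exact hpt

theorem eqOn_of_isLQMMildSolution (hD : D.IsMonotoneScalar v g) (hE : IsC0Semigroup E)
    (hT : 0 < T) {s s' : ℝ → ℝ} (h : D.IsLQMMildSolution E T z₀ P r z s)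
    (h' : D.IsLQMMildSolution E T z₀ P' r' z' s') :
    EqOn P P' (Icc 0 T) ∧ EqOn r r' (Icc 0 T) ∧ EqOn z z' (Icc 0 T) ∧ EqOn s s' (Icc 0 T) := by
  have hP := hD.eqOn_of_isMildRiccati hE hT.le h.riccati h'.riccati
  obtain ⟨hz, hr⟩ := hD.eqOn_of_isMildForwardBackward hE hT h.riccati h.forwardBackward
    (h'.forwardBackward.congr hP (eqOn_refl _ _) (eqOn_refl _ _))
  refine ⟨hP, hr, hz, fun t ht => ?_⟩
  rw [h.eq_s t ht, h'.eq_s t ht, hz (right_mem_Icc.2 hT.le)]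
  congr 1
  refine intervalIntegral.integral_congr fun τ hτ => ?_
  rw [uIcc_of_le ht.2] at hτ
  have hτT : τ ∈ Icc 0 T := ⟨ht.1.trans hτ.1, hτ.2⟩
  simp only [hP hτT, hz hτT, hr hτT]

end IsMonotoneScalar

end LQMData

end LQMSolution

section ProductionData

open ContinuousLinearMap (adjoint)
open InnerProductSpace (rankOne)

theorem toSpanSingleton_comp_adjoint_toSpanSingleton {H : Type*} [NormedAddCommGroup H]
    [InnerProductSpace ℝ H] [CompleteSpace H] (x : H) :
    ContinuousLinearMap.toSpanSingleton ℝ x ∘L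
      adjoint (ContinuousLinearMap.toSpanSingleton ℝ x) = rankOne ℝ x x := by
  rw [ContinuousLinearMap.adjoint_toSpanSingleton]
  rfl

theorem delayProj_eq_rankOne (d : ℝ) : delayProj d = rankOne ℝ
    (WithLp.toLp 2 ((1 : ℝ), (0 : DelayL2 d))) (WithLp.toLp 2 ((1 : ℝ), (0 : DelayL2 d))) := by
  ext1 x
  have hinner : ⟪WithLp.toLp 2 ((1 : ℝ), (0 : DelayL2 d)), x⟫_ℝ = x.fst := by
    simp [WithLp.prod_inner_apply]
  have hproj : delayProj d x = WithLp.toLp 2 (x.fst, (0 : DelayL2 d)) := rfl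
  rw [InnerProductSpace.rankOne_apply, hinner, hproj, ← WithLp.toLp_smul, Prod.smul_mk, smul_zero,
    smul_eq_mul, mul_one]

theorem isPositive_delayProj (d : ℝ) : (delayProj d).IsPositive :=
  delayProj_eq_rankOne d ▸ InnerProductSpace.isPositive_rankOne_self _

theorem BRB_productionData (d β γ η : ℝ) {r : ℝ} (hr : 0 < r) (σ : ℝ) (b : DelayL2 d) :
    (productionData d β γ η r σ b).BRB =
      rankOne ℝ ((√r)⁻¹ • WithLp.toLp 2 ((1 : ℝ), b)) ((√r)⁻¹ • WithLp.toLp 2 ((1 : ℝ), b)) := by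
  have hinverse : (r • ContinuousLinearMap.id ℝ ℝ).inverse = r⁻¹ • ContinuousLinearMap.id ℝ ℝ := by
    refine ContinuousLinearMap.inverse_eq ?_ ?_ <;> ext <;> simp [hr.ne']
  simp only [LQMData.BRB, productionData]
  rw [hinverse, ContinuousLinearMap.smul_comp, ContinuousLinearMap.id_comp,
    ContinuousLinearMap.comp_smul, toSpanSingleton_comp_adjoint_toSpanSingleton]
  ext1 x
  simp only [smul_apply, InnerProductSpace.rankOne_apply, inner_smul_left, smul_smul,
    conj_trivial]
  rw [mul_right_comm, ← mul_inv, Real.mul_self_sqrt hr.le]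

theorem isMonotoneScalar_productionData {d β γ : ℝ} (hβγ : -1 ≤ β * γ) (η : ℝ) {r : ℝ}
    (hr : 0 < r) (σ : ℝ) (b : DelayL2 d) :
    (productionData d β γ η r σ b).IsMonotoneScalar
      ((√r)⁻¹ • WithLp.toLp 2 ((1 : ℝ), b)) (WithLp.toLp 2 (σ, (0 : DelayL2 d))) := by
  have hcoupled : ((0 : DelaySpace d →L[ℝ] DelaySpace d) + delayProj d +
      -(delayProj d ∘L ((-(β * γ)) • ContinuousLinearMap.id ℝ (DelaySpace d)))).IsPositive := by
    have hsum : (0 : DelaySpace d →L[ℝ] DelaySpace d) + delayProj d +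
        -(delayProj d ∘L ((-(β * γ)) • ContinuousLinearMap.id ℝ (DelaySpace d)))
          = (1 + β * γ) • delayProj d := by
      rw [ContinuousLinearMap.comp_smul, ContinuousLinearMap.comp_id]
      module
    exact hsum ▸ (isPositive_delayProj d).smul_of_nonneg (by linarith)
  have hproj : ((0 : DelaySpace d →L[ℝ] DelaySpace d) + delayProj d).IsPositive :=
    (zero_add (delayProj d)).symm ▸ isPositive_delayProj d
  refine ⟨BRB_productionData d β γ η hr σ b, toSpanSingleton_comp_adjoint_toSpanSingleton _, ?_,
    hproj, hproj, hcoupled, hcoupled⟩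
  have : Continuous fun z : DelaySpace d => z.fst := WithLp.continuous_fst 2 ℝ (DelayL2 d)
  simp only [productionData]
  fun_prop

end ProductionData

section DelaySemigroup

variable {d : ℝ}

/-- Extension of a function on `[-d, 0]` to the real line by zero. -/
noncomputable def zeroExt (x : DelayL2 d) : ℝ → ℝ := (Icc (-d) 0).indicator x

theorem zeroExt_of_mem (x : DelayL2 d) {ξ : ℝ} (h : ξ ∈ Icc (-d) 0) : zeroExt x ξ = x ξ :=
  indicator_of_mem h _

theorem zeroExt_of_notMem (x : DelayL2 d) {ξ : ℝ} (h : ξ ∉ Icc (-d) 0) : zeroExt x ξ = 0 :=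
  indicator_of_notMem h _

theorem memLp_zeroExt (x : DelayL2 d) : MemLp (zeroExt x) 2 volume :=
  (memLp_indicator_iff_restrict measurableSet_Icc).2 (Lp.memLp x)

theorem integrable_zeroExt (x : DelayL2 d) : Integrable (zeroExt x) :=
  (integrable_indicator_iff measurableSet_Icc).2 ((Lp.memLp x).integrable one_le_two)

theorem intervalIntegrable_zeroExt (x : DelayL2 d) (a b : ℝ) :
    IntervalIntegrable (zeroExt x) volume a b :=
  (integrable_zeroExt x).intervalIntegrable

/-- Extension by zero as a bounded operator `L²(-d,0) → L²(ℝ)`. -/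
noncomputable def zeroExtL (d : ℝ) : DelayL2 d →L[ℝ] Lp ℝ 2 (volume : Measure ℝ) :=
  LinearMap.mkContinuous
    { toFun := fun x => (memLp_zeroExt x).toLp _
      map_add' := fun x y => by
        rw [← MemLp.toLp_add, MemLp.toLp_eq_toLp_iff]
        refine ((ae_eq_restrict_iff_indicator_ae_eq measurableSet_Icc).1 (Lp.coeFn_add x y)).trans
          (Eventually.of_forall fun ξ => ?_)
        exact congrFun (indicator_add (Icc (-d) 0) (x : ℝ → ℝ) y) ξ
      map_smul' := fun c x => by
        rw [RingHom.id_apply, ← MemLp.toLp_const_smul, MemLp.toLp_eq_toLp_iff]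
        refine ((ae_eq_restrict_iff_indicator_ae_eq measurableSet_Icc).1 (Lp.coeFn_smul c x)).trans
          (Eventually.of_forall fun ξ => ?_)
        exact congrFun (indicator_const_smul (Icc (-d) 0) c (x : ℝ → ℝ)) ξ } 1 fun x => by
    rw [one_mul]
    change ‖(memLp_zeroExt x).toLp _‖ ≤ _
    rw [Lp.norm_toLp, Lp.norm_def, zeroExt, eLpNorm_indicator_eq_eLpNorm_restrict measurableSet_Icc]

theorem coeFn_zeroExtL (x : DelayL2 d) : zeroExtL d x =ᵐ[volume] zeroExt x :=
  MemLp.coeFn_toLp (memLp_zeroExt x)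

/-- Translation by `t` to the right on `L²(-d,0)`, with zeros shifted in. -/
noncomputable def delayShift (d t : ℝ) : DelayL2 d →L[ℝ] DelayL2 d :=
  LpToLpRestrictCLM ℝ ℝ ℝ volume 2 (Icc (-d) 0) ∘L
    (Lp.compMeasurePreservingₗᵢ ℝ (fun ξ : ℝ => ξ - t)
      (measurePreserving_sub_right volume t)).toContinuousLinearMap ∘L zeroExtL d

theorem coeFn_delayShift (t : ℝ) (x : DelayL2 d) :
    delayShift d t x =ᵐ[volume.restrict (Icc (-d) 0)] fun ξ => zeroExt x (ξ - t) := by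
  have hsub := measurePreserving_sub_right (volume : Measure ℝ) t
  exact (LpToLpRestrictCLM_coeFn ℝ (Icc (-d) 0) _).trans (ae_restrict_of_ae
    ((Lp.coeFn_compMeasurePreserving (zeroExtL d x) hsub).trans
      (hsub.quasiMeasurePreserving.ae_eq_comp (coeFn_zeroExtL x))))

theorem continuous_delayShift (x : DelayL2 d) : Continuous fun t => delayShift d t x := by
  let translation : ℝ → C(ℝ, ℝ) := (ContinuousMap.mk fun p : ℝ × ℝ => p.2 - p.1).curry
  have htranslate : Continuous fun t : ℝ => Lp.compMeasurePreserving (fun ξ : ℝ => ξ - t)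
      (measurePreserving_sub_right volume t) (zeroExtL d x) :=
    continuous_const.compMeasurePreservingLp (f := fun _ : ℝ => zeroExtL d x) (g := translation)
      (ContinuousMap.continuous _) (measurePreserving_sub_right volume) ENNReal.ofNat_ne_top
  exact (LpToLpRestrictCLM ℝ ℝ ℝ volume 2 (Icc (-d) 0)).continuous.comp htranslate

theorem ae_zeroExt_delayShift {t : ℝ} (ht : 0 ≤ t) (x : DelayL2 d) :
    ∀ᵐ ξ, ξ ≤ 0 → zeroExt (delayShift d t x) ξ = zeroExt x (ξ - t) := by
  filter_upwards [(ae_eq_restrict_iff_indicator_ae_eq measurableSet_Icc).1 (coeFn_delayShift t x)]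
    with ξ hξ hξ0
  refine Eq.trans hξ ?_
  by_cases h : -d ≤ ξ
  · exact indicator_of_mem (show ξ ∈ Icc (-d) 0 from ⟨h, hξ0⟩) _
  · rw [indicator_of_notMem fun h' => h h'.1,
      zeroExt_of_notMem x fun h' => h (by linarith [h'.1])]

theorem delayShift_zero (x : DelayL2 d) : delayShift d 0 x = x := by
  refine Lp.ext ((coeFn_delayShift 0 x).trans ?_)
  filter_upwards [ae_restrict_mem measurableSet_Icc] with ξ hξ
  rw [sub_zero, zeroExt_of_mem x hξ]

theorem delayShift_add {s t : ℝ} (hs : 0 ≤ s) (ht : 0 ≤ t) (x : DelayL2 d) :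
    delayShift d (s + t) x = delayShift d s (delayShift d t x) := by
  refine Lp.ext ((coeFn_delayShift (s + t) x).trans ((coeFn_delayShift s _).trans ?_).symm)
  have hshift := (measurePreserving_sub_right volume s).quasiMeasurePreserving.ae
    (ae_zeroExt_delayShift ht x)
  filter_upwards [ae_restrict_mem measurableSet_Icc, ae_restrict_of_ae hshift] with ξ hξ hξs
  rw [hξs (by linarith [hξ.2]), sub_sub]

theorem delayShift_eq_zero {t : ℝ} (ht : d ≤ t) (x : DelayL2 d) : delayShift d t x = 0 := by
  refine Lp.ext ((coeFn_delayShift t x).trans (EventuallyEq.trans ?_ (Lp.coeFn_zero _ _ _).symm))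
  filter_upwards [ae_restrict_mem measurableSet_Icc, ae_restrict_of_ae (Measure.ae_ne volume 0)]
    with ξ hξ hne
  exact zeroExt_of_notMem x fun h => hne (le_antisymm hξ.2 (by linarith [h.1]))

/-- The functional `x ↦ ∫_{-t}^0 x` on `L²(-d,0)`, that is, the mass which translation to the right
by `t` moves out of `[-d, 0]`. -/
noncomputable def delayMass (d t : ℝ) : DelayL2 d →L[ℝ] ℝ :=
  innerSL ℝ (indicatorConstLp 2 (μ := volume.restrict (Icc (-d) 0)) (s := Ioc (-t) 0)
    measurableSet_Ioc (measure_ne_top _ _) (1 : ℝ))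

theorem delayMass_apply {t : ℝ} (ht : 0 ≤ t) (x : DelayL2 d) :
    delayMass d t x = ∫ ξ in (-t)..0, zeroExt x ξ := by
  rw [delayMass, innerSL_apply_apply, L2.inner_indicatorConstLp_one,
    intervalIntegral.integral_of_le (by linarith), zeroExt, setIntegral_indicator measurableSet_Icc,
    Measure.restrict_restrict measurableSet_Ioc]

theorem delayMass_add {s t : ℝ} (hs : 0 ≤ s) (ht : 0 ≤ t) (x : DelayL2 d) :
    delayMass d (s + t) x = delayMass d t x + delayMass d s (delayShift d t x) := by
  have hshift : ∫ ξ in (-s)..0, zeroExt (delayShift d t x) ξ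
      = ∫ ξ in (-s)..0, zeroExt x (ξ - t) := by
    refine intervalIntegral.integral_congr_ae ?_
    filter_upwards [ae_zeroExt_delayShift ht x] with ξ hξ hmem
    rw [uIoc_of_le (by linarith)] at hmem
    exact hξ hmem.2
  rw [delayMass_apply (add_nonneg hs ht), delayMass_apply ht, delayMass_apply hs, hshift,
    intervalIntegral.integral_comp_sub_right, add_comm (∫ ξ in (-t)..0, zeroExt x ξ), zero_sub,
    intervalIntegral.integral_add_adjacent_intervals (intervalIntegrable_zeroExt x _ _)
      (intervalIntegrable_zeroExt x _ _), neg_add']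

/-- The semigroup `e^{tA} (x₀, x₁) = (x₀ + ∫_{-t}^0 x₁, x₁(· - t))` on `ℝ × L²(-d,0)`. -/
noncomputable def delaySemigroup (d t : ℝ) : DelaySpace d →L[ℝ] DelaySpace d :=
  (WithLp.prodContinuousLinearEquiv 2 ℝ ℝ (DelayL2 d)).symm.toContinuousLinearMap ∘L
    ((ContinuousLinearMap.fst ℝ ℝ (DelayL2 d)
        + delayMass d t ∘L ContinuousLinearMap.snd ℝ ℝ (DelayL2 d)).prod
      (delayShift d t ∘L ContinuousLinearMap.snd ℝ ℝ (DelayL2 d))) ∘L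
      (WithLp.prodContinuousLinearEquiv 2 ℝ ℝ (DelayL2 d)).toContinuousLinearMap

theorem delaySemigroup_apply (t : ℝ) (x : DelaySpace d) : delaySemigroup d t x
    = WithLp.toLp 2 (x.fst + delayMass d t x.snd, delayShift d t x.snd) := rfl

theorem isC0Semigroup_delaySemigroup (d : ℝ) : IsC0Semigroup (delaySemigroup d) where
  map_zero := by
    ext1 x
    rw [delaySemigroup_apply, delayShift_zero, delayMass_apply le_rfl, neg_zero,
      intervalIntegral.integral_same, add_zero]
    rfl
  map_add s t hs ht := by
    ext1 x
    rw [ContinuousLinearMap.comp_apply, delaySemigroup_apply, delaySemigroup_apply,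
      delaySemigroup_apply, delayShift_add hs ht, delayMass_add hs ht, ← add_assoc]
    rfl
  continuousOn x := by
    have hprimitive : Continuous fun t => ∫ ξ in (-t)..0, zeroExt x.snd ξ := by
      simp_rw [intervalIntegral.integral_symm 0]
      exact ((intervalIntegral.continuous_primitive
        (intervalIntegrable_zeroExt x.snd) 0).comp continuous_neg).neg
    have hmass : ContinuousOn (fun t => delayMass d t x.snd) (Ici 0) :=
      hprimitive.continuousOn.congr fun t ht => delayMass_apply ht _
    exact (WithLp.prodContinuousLinearEquiv 2 ℝ ℝ (DelayL2 d)).symm.continuous.comp_continuousOn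
      ((continuousOn_const.add hmass).prodMk (continuous_delayShift x.snd).continuousOn)

end DelaySemigroup

section DuBoisReymond

variable {a b : ℝ}

theorem exists_Icc_superset_of_isClosed_subset_Ioo {K : Set ℝ} (hK : IsClosed K)
    (hKab : K ⊆ Ioo a b) : ∃ a' b', a < a' ∧ b' < b ∧ K ⊆ Icc a' b' := by
  have hKc : IsCompact K := isCompact_Icc.of_isClosed_subset hK (hKab.trans Ioo_subset_Icc_self)
  rcases K.eq_empty_or_nonempty with rfl | hne
  · exact ⟨a + 1, b - 1, lt_add_one a, sub_one_lt b, empty_subset _⟩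
  · obtain ⟨a', ha'K, ha'⟩ := hKc.exists_isLeast hne
    obtain ⟨b', hb'K, hb'⟩ := hKc.exists_isGreatest hne
    exact ⟨a', b', (hKab ha'K).1, (hKab hb'K).2, fun ξ hξ => ⟨ha' hξ, hb' hξ⟩⟩

theorem integral_eq_setIntegral_of_tsupport_subset_Ioo {f : ℝ → ℝ} (hf : tsupport f ⊆ Ioo a b) :
    ∫ ξ, f ξ = ∫ ξ in Icc a b, f ξ :=
  (setIntegral_eq_integral_of_forall_compl_eq_zero fun _ hξ =>
    image_eq_zero_of_notMem_tsupport fun h => hξ (Ioo_subset_Icc_self (hf h))).symm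

theorem tsupport_intervalIntegral_subset_Ioo {g : ℝ → ℝ} (hgab : tsupport g ⊆ Ioo a b)
    (hg : ∫ ξ, g ξ = 0) :
    tsupport (fun ξ => ∫ η in a..ξ, g η) ⊆ Ioo a b := by
  obtain ⟨a', b', haa', hb'b, hgab'⟩ :=
    exists_Icc_superset_of_isClosed_subset_Ioo (isClosed_tsupport g) hgab
  have hsupport : Function.support (fun ξ => ∫ η in a..ξ, g η) ⊆ Icc a' b' := fun ξ hξ => by
    by_contra hmem
    refine hξ ?_
    rcases lt_or_ge ξ a' with hξa' | ha'ξ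
    · refine (intervalIntegral.integral_congr fun η hη => ?_).trans intervalIntegral.integral_zero
      refine image_eq_zero_of_notMem_tsupport fun h => ?_
      exact (max_lt haa' hξa').not_ge ((hgab' h).1.trans hη.2)
    · refine (intervalIntegral.integral_eq_integral_of_support_subset fun η hη => ?_).trans hg
      have hη' := subset_tsupport g hη
      exact ⟨(hgab hη').1, (hgab' hη').2.trans (not_le.1 fun h => hmem ⟨ha'ξ, h⟩).le⟩
  exact (closure_minimal hsupport isClosed_Icc).trans (Icc_subset_Ioo haa' hb'b)

theorem exists_contDiff_deriv_eq_of_integral_eq_zero {g : ℝ → ℝ} (hg : ContDiff ℝ ∞ g)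
    (hgab : tsupport g ⊆ Ioo a b) (hg0 : ∫ ξ, g ξ = 0) :
    ∃ φ : ℝ → ℝ, ContDiff ℝ ∞ φ ∧ tsupport φ ⊆ Ioo a b ∧ deriv φ = g := by
  have hderiv : ∀ ξ, HasDerivAt (fun ξ => ∫ η in a..ξ, g η) (g ξ) ξ := fun ξ =>
    (hg.continuous.integral_hasStrictDerivAt a ξ).hasDerivAt
  have hderiv_eq : deriv (fun ξ => ∫ η in a..ξ, g η) = g := funext fun ξ => (hderiv ξ).deriv
  exact ⟨_, contDiff_infty_iff_deriv.2 ⟨fun ξ => (hderiv ξ).differentiableAt, hderiv_eq.symm ▸ hg⟩,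
    tsupport_intervalIntegral_subset_Ioo hgab hg0, hderiv_eq⟩

theorem exists_contDiff_integral_eq_one (hab : a < b) :
    ∃ ρ : ℝ → ℝ, ContDiff ℝ ∞ ρ ∧ HasCompactSupport ρ ∧ tsupport ρ ⊆ Ioo a b ∧ ∫ ξ, ρ ξ = 1 := by
  let bump : ContDiffBump ((a + b) / 2) :=
    { rIn := (b - a) / 8
      rOut := (b - a) / 4
      rIn_pos := by linarith
      rIn_lt_rOut := by linarith }
  refine ⟨bump.normed volume, bump.contDiff_normed, bump.hasCompactSupport_normed, ?_,
    bump.integral_normed⟩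
  rw [bump.tsupport_normed_eq, Real.closedBall_eq_Icc]
  exact Icc_subset_Ioo (by simp only [bump]; linarith) (by simp only [bump]; linarith)

theorem integral_mul_eq_integral_mul_integral_mul {w ρ ψ : ℝ → ℝ} (hw : IntegrableOn w (Icc a b))
    (h : ∀ φ : ℝ → ℝ, ContDiff ℝ ∞ φ → tsupport φ ⊆ Ioo a b →
      ∫ ξ in Icc a b, w ξ * deriv φ ξ = 0)
    (hρ : ContDiff ℝ ∞ ρ) (hρc : HasCompactSupport ρ) (hρab : tsupport ρ ⊆ Ioo a b)
    (hρ1 : ∫ ξ, ρ ξ = 1)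
    (hψ : ContDiff ℝ ∞ ψ) (hψc : HasCompactSupport ψ) (hψab : tsupport ψ ⊆ Ioo a b) :
    ∫ ξ in Icc a b, w ξ * ψ ξ = (∫ ξ, ψ ξ) * ∫ ξ in Icc a b, w ξ * ρ ξ := by
  have hwmul : ∀ {f : ℝ → ℝ}, Continuous f → IntegrableOn (fun ξ => w ξ * f ξ) (Icc a b) :=
    fun hf => hw.mul_continuousOn hf.continuousOn isCompact_Icc
  set m := ∫ ξ, ψ ξ
  -- `ψ - m ρ` has integral zero, hence is the derivative of a test function.
  have hsupport : tsupport (fun ξ => ψ ξ - m * ρ ξ) ⊆ Ioo a b :=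
    (tsupport_sub _ _).trans (union_subset hψab (tsupport_mul_subset_right.trans hρab))
  have hintegral : ∫ ξ, (ψ ξ - m * ρ ξ) = 0 := by
    rw [integral_sub (hψ.continuous.integrable_of_hasCompactSupport hψc)
      ((hρ.continuous.integrable_of_hasCompactSupport hρc).const_mul m), integral_const_mul, hρ1,
      mul_one, sub_self]
  obtain ⟨φ, hφ, hφab, hφ'⟩ := exists_contDiff_deriv_eq_of_integral_eq_zero
    (hψ.sub (contDiff_const.mul hρ)) hsupport hintegral
  have horthogonal := h φ hφ hφab
  simp only [hφ', mul_sub, mul_left_comm _ m] at horthogonal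
  rwa [integral_sub (hwmul hψ.continuous) ((hwmul hρ.continuous).const_mul m),
    integral_const_mul, sub_eq_zero] at horthogonal

theorem ae_eq_const_of_integral_mul_deriv_eq_zero (hab : a < b) {w : ℝ → ℝ}
    (hw : IntegrableOn w (Icc a b))
    (h : ∀ φ : ℝ → ℝ, ContDiff ℝ ∞ φ → tsupport φ ⊆ Ioo a b →
      ∫ ξ in Icc a b, w ξ * deriv φ ξ = 0) :
    ∃ c, w =ᵐ[volume.restrict (Icc a b)] fun _ => c := by
  obtain ⟨ρ, hρ, hρc, hρab, hρ1⟩ := exists_contDiff_integral_eq_one hab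
  refine ⟨∫ ξ in Icc a b, w ξ * ρ ξ, ?_⟩
  set c := ∫ ξ in Icc a b, w ξ * ρ ξ
  have hae : ∀ᵐ ξ, ξ ∈ Ioo a b → w ξ - c = 0 := by
    have hwc : IntegrableOn (fun ξ => w ξ - c) (Icc a b) :=
      hw.sub (integrableOn_const measure_Icc_lt_top.ne)
    refine isOpen_Ioo.ae_eq_zero_of_integral_contDiff_smul_eq_zero
      (hwc.mono_set Ioo_subset_Icc_self).locallyIntegrableOn fun ψ hψ hψc hψab => ?_
    calc ∫ ξ, ψ ξ • (w ξ - c) = ∫ ξ in Icc a b, ψ ξ * (w ξ - c) :=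
          integral_eq_setIntegral_of_tsupport_subset_Ioo (tsupport_mul_subset_left.trans hψab)
      _ = (∫ ξ in Icc a b, w ξ * ψ ξ) - (∫ ξ in Icc a b, ψ ξ) * c := by
          rw [← integral_mul_const, ← integral_sub
            (hw.mul_continuousOn hψ.continuous.continuousOn isCompact_Icc)
            (hψ.continuous.integrableOn_Icc.mul_const c)]
          simp only [mul_sub, mul_comm]
      _ = 0 := by
          rw [integral_mul_eq_integral_mul_integral_mul hw h hρ hρc hρab hρ1 hψ hψc hψab,
            integral_eq_setIntegral_of_tsupport_subset_Ioo hψab, sub_self]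
  rw [← Measure.restrict_congr_set (Ioo_ae_eq_Icc (μ := volume) (a := a) (b := b))]
  refine (ae_restrict_iff' measurableSet_Ioo).2 ?_
  filter_upwards [hae] with ξ hξ hm using sub_eq_zero.1 (hξ hm)

end DuBoisReymond

section DelayGenerator

variable {d : ℝ}

/-- The primitive `ξ ↦ ∫_{-d}^ξ y` of a function on `[-d, 0]`. -/
noncomputable def delayPrimitive (y : DelayL2 d) (ξ : ℝ) : ℝ := ∫ η in (-d)..ξ, zeroExt y η

theorem continuous_delayPrimitive (y : DelayL2 d) : Continuous (delayPrimitive y) :=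
  intervalIntegral.continuous_primitive (intervalIntegrable_zeroExt y) (-d)

theorem delayPrimitive_eq_integral_sub (y : DelayL2 d) {ξ : ℝ} (hξ : ξ ≤ 0) :
    delayPrimitive y ξ = ∫ s in (0 : ℝ)..d, zeroExt y (ξ - s) := by
  have hbelow : ∫ η in (ξ - d)..(-d), zeroExt y η = 0 := by
    refine intervalIntegral.integral_zero_ae ?_
    filter_upwards [Measure.ae_ne volume (-d)] with η hne hη
    rw [uIoc_of_le (by linarith)] at hη
    exact zeroExt_of_notMem y fun h => hne (le_antisymm hη.2 h.1)
  rw [intervalIntegral.integral_comp_sub_left, sub_zero,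
    ← intervalIntegral.integral_add_adjacent_intervals (intervalIntegrable_zeroExt y _ (-d))
      (intervalIntegrable_zeroExt y _ _), hbelow, zero_add, delayPrimitive]

theorem integrable_uncurry_comp_sub {f : ℝ → ℝ} (hf : Integrable f) {μ : Measure ℝ}
    [IsFiniteMeasure μ] :
    Integrable (Function.uncurry fun s ξ : ℝ => f (ξ - s)) (μ.prod volume) := by
  refine (((integrable_const (1 : ℝ)).convolution_integrand (ContinuousLinearMap.mul ℝ ℝ)
    hf).swap).congr (Eventually.of_forall fun p => ?_)
  simp [Function.uncurry]

theorem coeFn_integral_delayShift (hd : 0 ≤ d) (y : DelayL2 d) :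
    (∫ s in (0 : ℝ)..d, delayShift d s y : DelayL2 d)
      =ᵐ[volume.restrict (Icc (-d) 0)] delayPrimitive y := by
  refine Integrable.ae_eq_of_forall_setIntegral_eq _ _
    ((Lp.memLp _).integrable one_le_two)
    (continuous_delayPrimitive y).integrableOn_Icc fun A hA _ => ?_
  have hpairing : ∀ x : DelayL2 d, ∫ ξ in A, x ξ ∂(volume.restrict (Icc (-d) 0))
      = ⟪indicatorConstLp 2 (μ := volume.restrict (Icc (-d) 0)) hA (measure_ne_top _ _) (1 : ℝ),
        x⟫_ℝ := fun x => (L2.inner_indicatorConstLp_one hA (measure_ne_top _ _) x).symm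
  have hshift : ∀ s, ∫ ξ in A, delayShift d s y ξ ∂(volume.restrict (Icc (-d) 0))
      = ∫ ξ in A, zeroExt y (ξ - s) ∂(volume.restrict (Icc (-d) 0)) := fun s =>
    integral_congr_ae (ae_restrict_of_ae (coeFn_delayShift s y))
  have hintegrable : Integrable (Function.uncurry fun s ξ : ℝ => zeroExt y (ξ - s))
      ((volume.restrict (uIoc 0 d)).prod ((volume.restrict (Icc (-d) 0)).restrict A)) := by
    rw [uIoc_of_le hd]
    exact (integrable_uncurry_comp_sub (integrable_zeroExt y)).mono_measure
      (Measure.prod_mono le_rfl (Measure.restrict_le_self.trans Measure.restrict_le_self))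
  rw [hpairing, inner_intervalIntegral _ (continuous_delayShift y)]
  simp_rw [← hpairing, hshift]
  rw [intervalIntegral_integral_swap hintegrable]
  refine integral_congr_ae ?_
  filter_upwards [ae_restrict_of_ae (ae_restrict_mem (measurableSet_Icc (a := -d) (b := 0)))]
    with ξ hξ
  exact (delayPrimitive_eq_integral_sub y hξ.2).symm

theorem ae_eq_neg_delayPrimitive_iff (hd : 0 ≤ d) (x y : DelayL2 d) :
    (x =ᵐ[volume.restrict (Icc (-d) 0)] fun ξ => -delayPrimitive y ξ) ↔
      x = -∫ s in (0 : ℝ)..d, delayShift d s y := by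
  have hprimitive : (-∫ s in (0 : ℝ)..d, delayShift d s y : DelayL2 d)
      =ᵐ[volume.restrict (Icc (-d) 0)] fun ξ => -delayPrimitive y ξ :=
    (Lp.coeFn_neg _).trans (coeFn_integral_delayShift hd y).neg
  exact ⟨fun hx => Lp.ext (hx.trans hprimitive.symm), fun hx => hx ▸ hprimitive⟩

theorem integral_delayPrimitive_mul_deriv (hd : 0 ≤ d) (y : DelayL2 d) {φ : ℝ → ℝ}
    (hφ : ContDiff ℝ 1 φ) (hφ0 : φ 0 = 0) :
    ∫ ξ in Icc (-d) 0, delayPrimitive y ξ * deriv φ ξ = -∫ ξ in Icc (-d) 0, y ξ * φ ξ := by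
  have hd' : -d ≤ 0 := neg_nonpos.2 hd
  have hdφ : Continuous (deriv φ) := hφ.continuous_deriv le_rfl
  have hintegrable : Integrable (Function.uncurry fun τ σ : ℝ => deriv φ τ * zeroExt y σ)
      ((volume.restrict (Ioc (-d) 0)).prod (volume.restrict (Ioc (-d) 0))) :=
    (hdφ.integrableOn_Icc.mono_set Ioc_subset_Icc_self).mul_prod (integrable_zeroExt y).restrict
  have hftc : ∀ σ, ∫ τ in σ..0, deriv φ τ = -φ σ := fun σ => by
    rw [intervalIntegral.integral_deriv_eq_sub
      (fun ξ _ => hφ.differentiable one_ne_zero ξ) (hdφ.intervalIntegrable _ _), hφ0, zero_sub]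
  calc ∫ ξ in Icc (-d) 0, delayPrimitive y ξ * deriv φ ξ
      = ∫ τ in (-d)..0, ∫ σ in (-d)..τ, deriv φ τ * zeroExt y σ := by
        simp only [intervalIntegral.integral_const_mul]
        rw [intervalIntegral.integral_of_le hd', ← integral_Icc_eq_integral_Ioc]
        simp only [mul_comm (deriv φ _), delayPrimitive]
    _ = ∫ σ in (-d)..0, ∫ τ in σ..0, deriv φ τ * zeroExt y σ :=
        intervalIntegral_triangle_swap hd' hintegrable
    _ = -∫ ξ in Icc (-d) 0, y ξ * φ ξ := by
        simp only [intervalIntegral.integral_mul_const, hftc]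
        rw [intervalIntegral.integral_of_le hd', ← integral_Icc_eq_integral_Ioc, ← integral_neg]
        refine setIntegral_congr_fun measurableSet_Icc fun σ hσ => ?_
        simp only [zeroExt_of_mem y hσ]
        ring

theorem isWeakDeriv_of_ae_eq_neg_delayPrimitive (hd : 0 ≤ d) {x y : DelayL2 d}
    (hx : x =ᵐ[volume.restrict (Icc (-d) 0)] fun ξ => -delayPrimitive y ξ) :
    IsWeakDeriv x (-y) := fun φ hφ hφd => by
  have hφ0 : φ 0 = 0 := image_eq_zero_of_notMem_tsupport fun h => lt_irrefl _ (hφd h).2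
  calc ∫ ξ in Icc (-d) 0, x ξ * deriv φ ξ
      = -∫ ξ in Icc (-d) 0, delayPrimitive y ξ * deriv φ ξ := by
        rw [← integral_neg]
        refine integral_congr_ae ?_
        filter_upwards [hx] with ξ hξ
        rw [hξ, neg_mul]
    _ = ∫ ξ in Icc (-d) 0, y ξ * φ ξ := by
        rw [integral_delayPrimitive_mul_deriv hd y (hφ.of_le (by simp)) hφ0, neg_neg]
    _ = -∫ ξ in Icc (-d) 0, (-y : DelayL2 d) ξ * φ ξ := by
        rw [← integral_neg]
        refine integral_congr_ae ?_
        filter_upwards [Lp.coeFn_neg y] with ξ hξ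
        rw [hξ, Pi.neg_apply, neg_mul, neg_neg]

theorem exists_ae_eq_const_of_isWeakDeriv_zero (hd : 0 < d) {x : DelayL2 d}
    (hx : IsWeakDeriv x 0) : ∃ c, x =ᵐ[volume.restrict (Icc (-d) 0)] fun _ => c := by
  refine ae_eq_const_of_integral_mul_deriv_eq_zero (neg_lt_zero.2 hd)
    ((Lp.memLp x).integrable one_le_two) fun φ hφ hφd => (hx φ hφ hφd).trans ?_
  rw [neg_eq_zero]
  refine integral_eq_zero_of_ae ?_
  filter_upwards [Lp.coeFn_zero ℝ 2 (volume.restrict (Icc (-d) 0))] with ξ hξ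
  simp only [hξ, Pi.zero_apply, zero_mul]

theorem IsWeakDeriv.sub {f g f' g' : DelayL2 d} (h : IsWeakDeriv f g) (h' : IsWeakDeriv f' g') :
    IsWeakDeriv (f - f') (g - g') := fun φ hφ hφd => by
  have hintegrable : ∀ (k : DelayL2 d) {ψ : ℝ → ℝ}, Continuous ψ →
      IntegrableOn (fun ξ => k ξ * ψ ξ) (Icc (-d) 0) := fun k _ hψ =>
    IntegrableOn.mul_continuousOn ((Lp.memLp k).integrable one_le_two) hψ.continuousOn isCompact_Icc
  have hsub : ∀ (k l : DelayL2 d) {ψ : ℝ → ℝ}, Continuous ψ →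
      ∫ ξ in Icc (-d) 0, (k - l : DelayL2 d) ξ * ψ ξ
        = (∫ ξ in Icc (-d) 0, k ξ * ψ ξ) - ∫ ξ in Icc (-d) 0, l ξ * ψ ξ := fun k l ψ hψ => by
    rw [← integral_sub (hintegrable k hψ) (hintegrable l hψ)]
    refine integral_congr_ae ?_
    filter_upwards [Lp.coeFn_sub k l] with ξ hξ
    rw [hξ, Pi.sub_apply, sub_mul]
  rw [hsub f f' (hφ.continuous_deriv (by simp)), hsub g g' hφ.continuous, h φ hφ hφd, h' φ hφ hφd]
  ring

theorem delayOperatorGraph_iff (hd : 0 < d) (x y : DelaySpace d) :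
    delayOperatorGraph d x y ↔
      (x.snd =ᵐ[volume.restrict (Icc (-d) 0)] fun ξ => -delayPrimitive y.snd ξ) ∧
        y.fst = -delayPrimitive y.snd 0 := by
  have hprimitive : delayPrimitive y.snd (-d) = 0 := intervalIntegral.integral_same
  have hcont := (continuous_delayPrimitive y.snd).neg
  constructor
  · rintro ⟨hweak, u, hu, hxu, hud, hy0⟩
    have hint := (ae_eq_neg_delayPrimitive_iff hd.le _ y.snd).2 rfl
    obtain ⟨c, hc⟩ := exists_ae_eq_const_of_isWeakDeriv_zero hd
      (sub_self (-y.snd) ▸ hweak.sub (isWeakDeriv_of_ae_eq_neg_delayPrimitive hd.le hint))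
    have hue : EqOn u (fun ξ => -delayPrimitive y.snd ξ + c) (Icc (-d) 0) := by
      refine Measure.eqOn_Icc_of_ae_eq volume (neg_lt_zero.2 hd).ne ?_ hu
        (hcont.add continuous_const).continuousOn
      filter_upwards [hc, hxu, hint, Lp.coeFn_sub x.snd _] with ξ hξc hξu hξint hξsub
      rw [hξsub, Pi.sub_apply, hξu, hξint] at hξc
      linarith
    have hc0 : c = 0 := by
      have := hue (left_mem_Icc.2 (neg_nonpos.2 hd.le))
      simpa only [hud, hprimitive, neg_zero, zero_add] using this.symm
    simp only [hc0, add_zero] at hue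
    refine ⟨?_, hy0.trans (hue (right_mem_Icc.2 (neg_nonpos.2 hd.le)))⟩
    filter_upwards [hxu, ae_restrict_mem measurableSet_Icc] with ξ hξ hmem
    rw [hξ, hue hmem]
  · rintro ⟨hx, hy0⟩
    exact ⟨isWeakDeriv_of_ae_eq_neg_delayPrimitive hd.le hx, fun ξ => -delayPrimitive y.snd ξ,
      hcont.continuousOn, hx, by simp only [hprimitive, neg_zero], hy0⟩

theorem tendsto_inv_smul_intervalIntegral {X : Type*} [NormedAddCommGroup X] [NormedSpace ℝ X]
    [CompleteSpace X] {f : ℝ → X} (hf : Continuous f) :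
    Tendsto (fun h : ℝ => h⁻¹ • ∫ s in (0 : ℝ)..h, f s) (𝓝[>] 0) (𝓝 (f 0)) := by
  have hslope := (hf.integral_hasStrictDerivAt 0 0).hasDerivAt
  rw [hasDerivAt_iff_tendsto_slope_zero] at hslope
  simp only [zero_add, intervalIntegral.integral_same, sub_zero] at hslope
  exact hslope.mono_left (nhdsWithin_mono _ fun h hh => ne_of_gt hh)

theorem hasDerivWithinAt_delayShift {x y : DelayL2 d}
    (h : Tendsto (fun h : ℝ => h⁻¹ • (delayShift d h x - x)) (𝓝[>] 0) (𝓝 y)) {t : ℝ}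
    (ht : 0 ≤ t) : HasDerivWithinAt (fun t => delayShift d t x) (delayShift d t y) (Ioi t) t := by
  rw [hasDerivWithinAt_iff_tendsto_slope' self_notMem_Ioi]
  have hsub : Tendsto (fun s : ℝ => s - t) (𝓝[>] t) (𝓝[>] 0) := by
    refine tendsto_nhdsWithin_of_tendsto_nhds_of_eventually_within _ ?_ ?_
    · exact (continuous_sub_right t).tendsto' t 0 (sub_self t) |>.mono_left nhdsWithin_le_nhds
    · filter_upwards [self_mem_nhdsWithin] with s hs using mem_Ioi.2 (sub_pos.2 hs)
  refine ((((delayShift d t).continuous.tendsto y).comp h).comp hsub).congr' ?_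
  filter_upwards [self_mem_nhdsWithin] with s hs
  simp only [Function.comp_apply, slope_def_module, map_smul, map_sub]
  rw [← delayShift_add ht (sub_pos.2 (mem_Ioi.1 hs)).le, add_sub_cancel]

theorem delayShift_integral_delayShift (hd : 0 ≤ d) (y : DelayL2 d) {h : ℝ} (hh : 0 ≤ h) :
    delayShift d h (∫ s in (0 : ℝ)..d, delayShift d s y) = ∫ s in h..d, delayShift d s y := by
  have hint : ∀ a b, IntervalIntegrable (fun s => delayShift d s y) volume a b := fun a b =>
    (continuous_delayShift y).intervalIntegrable _ _
  have htail : ∫ s in d..(d + h), delayShift d s y = 0 := by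
    refine (intervalIntegral.integral_congr fun s hs => ?_).trans intervalIntegral.integral_zero
    rw [uIcc_of_le (by linarith)] at hs
    exact delayShift_eq_zero hs.1 y
  calc delayShift d h (∫ s in (0 : ℝ)..d, delayShift d s y)
      = ∫ s in (0 : ℝ)..d, delayShift d (s + h) y := by
        rw [← (delayShift d h).intervalIntegral_comp_comm (hint 0 d)]
        refine intervalIntegral.integral_congr fun s hs => ?_
        rw [uIcc_of_le hd] at hs
        simp only [add_comm s h, delayShift_add hh hs.1]
    _ = ∫ s in h..(d + h), delayShift d s y := by
        rw [intervalIntegral.integral_comp_add_right (fun s => delayShift d s y), zero_add]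
    _ = ∫ s in h..d, delayShift d s y := by
        rw [← intervalIntegral.integral_add_adjacent_intervals (hint h d) (hint d (d + h)), htail,
          add_zero]

/-- The shift is nilpotent, so integrating the derivative of its orbit over `[0, d]` inverts the
generator. -/
theorem tendsto_delayShift_iff (hd : 0 ≤ d) (x y : DelayL2 d) :
    Tendsto (fun h : ℝ => h⁻¹ • (delayShift d h x - x)) (𝓝[>] 0) (𝓝 y) ↔
      x = -∫ s in (0 : ℝ)..d, delayShift d s y := by
  have hint : ∀ a b, IntervalIntegrable (fun s => delayShift d s y) volume a b := fun a b =>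
    (continuous_delayShift y).intervalIntegrable _ _
  constructor
  · intro hlim
    have hftc := intervalIntegral.integral_eq_sub_of_hasDeriv_right_of_le hd
      (continuous_delayShift x).continuousOn
      (fun t ht => hasDerivWithinAt_delayShift hlim ht.1.le) (hint 0 d)
    rw [hftc, delayShift_eq_zero le_rfl, delayShift_zero, zero_sub, neg_neg]
  · rintro rfl
    have haverage := tendsto_inv_smul_intervalIntegral (continuous_delayShift y)
    rw [delayShift_zero] at haverage
    refine haverage.congr' ?_
    filter_upwards [self_mem_nhdsWithin] with h hh
    rw [map_neg, delayShift_integral_delayShift hd y (le_of_lt hh),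
      ← intervalIntegral.integral_add_adjacent_intervals (hint 0 h) (hint h d)]
    abel_nf

theorem tendsto_delayMass (hd : 0 < d) {x y : DelayL2 d}
    (hx : x =ᵐ[volume.restrict (Icc (-d) 0)] fun ξ => -delayPrimitive y ξ) :
    Tendsto (fun h : ℝ => h⁻¹ • delayMass d h x) (𝓝[>] 0) (𝓝 (-delayPrimitive y 0)) := by
  have haverage := tendsto_inv_smul_intervalIntegral (f := fun s => -delayPrimitive y (-s))
    ((continuous_delayPrimitive y).comp continuous_neg).neg
  rw [neg_zero] at haverage
  refine haverage.congr' ?_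
  filter_upwards [Ioc_mem_nhdsGT hd] with h hh
  rw [delayMass_apply hh.1.le,
    intervalIntegral.integral_comp_neg (fun ξ => -delayPrimitive y ξ), neg_zero]
  congr 1
  refine intervalIntegral.integral_congr_ae ?_
  filter_upwards [(ae_restrict_iff' measurableSet_Icc).1 hx] with ξ hξ hmem
  rw [uIoc_of_le (by linarith [hh.1])] at hmem
  have hmem' : ξ ∈ Icc (-d) 0 := ⟨by linarith [hmem.1, hh.2], hmem.2⟩
  rw [zeroExt_of_mem x hmem', hξ hmem']

theorem tendsto_delaySemigroup_iff (x y : DelaySpace d) :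
    Tendsto (fun h : ℝ => h⁻¹ • (delaySemigroup d h x - x)) (𝓝[>] 0) (𝓝 y) ↔
      Tendsto (fun h : ℝ => h⁻¹ • delayMass d h x.snd) (𝓝[>] 0) (𝓝 y.fst) ∧
        Tendsto (fun h : ℝ => h⁻¹ • (delayShift d h x.snd - x.snd)) (𝓝[>] 0) (𝓝 y.snd) := by
  rw [(WithLp.prodContinuousLinearEquiv 2 ℝ ℝ
    (DelayL2 d)).toHomeomorph.isInducing.tendsto_nhds_iff, Prod.tendsto_iff]
  refine and_congr (iff_of_eq ?_) Iff.rfl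
  congr 1
  ext h
  change h⁻¹ • (x.fst + delayMass d h x.snd - x.fst) = h⁻¹ • delayMass d h x.snd
  rw [add_sub_cancel_left]

theorem isGeneratorGraph_delaySemigroup (hd : 0 < d) :
    IsGeneratorGraph (delaySemigroup d) (delayOperatorGraph d) := fun x y => by
  rw [tendsto_delaySemigroup_iff, delayOperatorGraph_iff hd, tendsto_delayShift_iff hd.le,
    ← ae_eq_neg_delayPrimitive_iff hd.le, and_comm]
  exact and_congr_left fun hx => ⟨fun hy => hy ▸ tendsto_delayMass hd hx,
    fun h => tendsto_nhds_unique h (tendsto_delayMass hd hx)⟩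

end DelayGenerator

theorem mainTheorem6_general (d T β γ η r σ : ℝ) (hd : 0 < d) (hT : 0 < T) (hβγ : -1 ≤ β * γ)
    (hr : 0 < r) (b : DelayL2 d) (z₀ : DelaySpace d) :
    (∃ E : ℝ → DelaySpace d →L[ℝ] DelaySpace d,
      IsC0Semigroup E ∧ IsGeneratorGraph E (delayOperatorGraph d)) ∧
    ∀ E : ℝ → DelaySpace d →L[ℝ] DelaySpace d,
      IsC0Semigroup E → IsGeneratorGraph E (delayOperatorGraph d) →
      (∃ (P : ℝ → DelaySpace d →L[ℝ] DelaySpace d) (ρ z : ℝ → DelaySpace d) (s : ℝ → ℝ),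
        (productionData d β γ η r σ b).IsLQMMildSolution E T z₀ P ρ z s) ∧
      ∀ (P P' : ℝ → DelaySpace d →L[ℝ] DelaySpace d) (ρ ρ' z z' : ℝ → DelaySpace d)
        (s s' : ℝ → ℝ),
        (productionData d β γ η r σ b).IsLQMMildSolution E T z₀ P ρ z s →
        (productionData d β γ η r σ b).IsLQMMildSolution E T z₀ P' ρ' z' s' →
        ∀ t ∈ Icc 0 T, P t = P' t ∧ ρ t = ρ' t ∧ z t = z' t ∧ s t = s' t := by
  have hD := isMonotoneScalar_productionData (d := d) hβγ η hr σ b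
  refine ⟨⟨delaySemigroup d, isC0Semigroup_delaySemigroup d, isGeneratorGraph_delaySemigroup hd⟩,
    fun E hE _ => ⟨hD.exists_isLQMMildSolution hE hT.le z₀, ?_⟩⟩
  intro P P' ρ ρ' z z' s s' h h' t ht
  obtain ⟨hP, hρ, hz, hs⟩ := hD.eqOn_of_isLQMMildSolution hE hT h h'
  exact ⟨hP ht, hρ ht, hz ht, hs ht⟩

theorem mainTheorem6
    (d T β γ η r σ : ℝ) (hd : 0 < d) (hT : 0 < T) (hβ : 0 < β) (hγ : 0 < γ) (hη : 0 < η)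
    (hr : 0 < r) (b : DelayL2 d) (hb : 0 ≤ b)
    [MeasurableSpace (DelaySpace d)] [BorelSpace (DelaySpace d)]
    (m₀ : Measure (DelaySpace d)) [IsProbabilityMeasure m₀]
    (hm₀ : Integrable (fun x : DelaySpace d => x) m₀) :
    (∃ E : ℝ → DelaySpace d →L[ℝ] DelaySpace d,
      IsC0Semigroup E ∧ IsGeneratorGraph E (delayOperatorGraph d)) ∧
    ∀ E : ℝ → DelaySpace d →L[ℝ] DelaySpace d,
      IsC0Semigroup E → IsGeneratorGraph E (delayOperatorGraph d) →
      (∃ (P : ℝ → DelaySpace d →L[ℝ] DelaySpace d) (ρ z : ℝ → DelaySpace d) (s : ℝ → ℝ),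
        (productionData d β γ η r σ b).IsLQMMildSolution E T (∫ x, x ∂m₀) P ρ z s) ∧
      ∀ (P P' : ℝ → DelaySpace d →L[ℝ] DelaySpace d) (ρ ρ' z z' : ℝ → DelaySpace d)
        (s s' : ℝ → ℝ),
        (productionData d β γ η r σ b).IsLQMMildSolution E T (∫ x, x ∂m₀) P ρ z s →
        (productionData d β γ η r σ b).IsLQMMildSolution E T (∫ x, x ∂m₀) P' ρ' z' s' →
        ∀ t ∈ Icc 0 T, P t = P' t ∧ ρ t = ρ' t ∧ z t = z' t ∧ s t = s' t :=
  mainTheorem6_general d T β γ η r σ hd hT (by linarith [mul_pos hβ hγ]) hr b _
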